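/- **Formulas.** Formulas are built from atoms ($\mathsf t$, $\mathsf f$, $p(t_1,\dots,t_n)$, $\bar p(t_1,\dots,t_n)$) by $\wedge,\vee,\exists x,\forall x$, with named bound variables. A formula is *rectified* if all bound variables (one for each quantifier occurrence) are distinct from one another and from all free variables. Let $\equiv$ be the congruence generated by commutativity and associativity of $\wedge$ and of $\vee$, by $\forall x.\forall y.A\equiv\forall y.\forall x.A$ and $\exists x.\exists y.A\equiv\exists y.\exists x.A$, and, for $x$ not free in $B$, by $\forall x.(A\vee B)\equiv(\forall x.A)\vee B$ and $\exists x.(A\wedge B)\equiv(\exists x.A)\wedge B$. **Graphs.** The labelled graph $\mathcal G(A)$ is defined by $\mathcal G(a)=\bullet a$ for an atom $a$, $\mathcal G(A\vee B)=\mathcal G(A)+\mathcal G(B)$, $\mathcal G(A\wedge B)=\mathcal G(A)\times\mathcal G(B)$, $\mathcal G(\forall x.A)=\bullet x+\mathcal G(A)$ and $\mathcal G(\exists x.A)=\bullet x\times\mathcal G(A)$, where $\bullet\alpha$ is a single vertex labelled $\alpha$, $+$ is disjoint union and $\times$ is join. In a finite graph whose vertices are labelled by atoms (*literals*) or variables (*binders*;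 an $x$-*binder* is labelled $x$), the *scope* of a binder is the smallest strong module with at least two vertices that contains it. (A module is a vertex set whose members have the same neighbours outside it; it is strong if it is comparable with or disjoint from every module.) A binder is *existential* if it is adjacent to every other vertex in its scope. An $x$-binder is *legal* if its scope contains no other $x$-binder and at least one literal; it *binds* the literals in its scope whose atom contains $x$. A *fograph* is such a graph that is $P_4$-free, has at least one literal, and has only legal binders. Its *binding graph* is the directed graph on its vertices with edges $(b,l)$ whenever $b$ binds $l$. **Skew bifibrations.** Let $\mathcal G,\mathcal H$ be fographs. A skew bifibration $\phi:\mathcal G\to\mathcal H$ is a map of vertices such that: 1. $\phi$ is a graph homomorphism, and there is a map $\rho$ from variables to variables, the identity at all but finitely many variables and at every variable not occurring in $\mathcal G$, such that the label of $\phi(v)$ is $\rho$ applied to the label of $v$, for every vertex $v$; 2. if $b$ is an existential binder, so is $\phi(b)$; 3. $\phi$ is a skew fibration: whenever $w\phi(v)$ is an edge of $\mathcal H$, there is an edge $\tilde w v$ of $\mathcal G$ such that $\phi(\tilde w)w$ is not an edge of $\mathcal H$; 4. $\phi$ is a fibration of the binding graphs: it is a homomorphism of directed graphs, and for every vertex $v$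 of $\mathcal G$ and every edge $(w,\phi(v))$ of the binding graph of $\mathcal H$ there is a unique $\tilde w$ such that $(\tilde w,v)$ is an edge of the binding graph of $\mathcal G$ and $\phi(\tilde w)=w$. **Derivations.** Consider the following rules, written premise $\to$ conclusion and applied inside any positive context $S\{\cdot\}$ (a formula with one hole in the position of an atom): - $\mathsf w$: $A\to A\vee B$; - $\mathsf w_\forall$: $A\to\forall x.A$, with $x$ not free in $A$; - $\mathsf{ac}$: $a\vee a\to a$, for an atom $a$; - $\mathsf m$: $(A\wedge C)\vee(B\wedge D)\to(A\vee B)\wedge(C\vee D)$; - $\equiv$: $A\to B$ whenever $A\equiv B$; - $\hat{\mathsf c}_\forall$: $\forall y.\forall x.Ax\to\forall x.Ax$; - $\hat{\mathsf m}_\forall$: $(\forall y.Ay)\vee(\forall z.Bz)\to\forall x.(Ax\vee Bx)$; - $\hat{\mathsf m}_\exists$: $(\exists y.Ay)\vee(\exists z.Bz)\to\exists x.(Ax\vee Bx)$. In the last three rules, $A\cdot$ and $B\cdot$ are formulas with a placeholder for a variable, $Ax$ is the result of putting $x$ for the placeholder of $A\cdot$, $x$ and $y$ do not occur in $A\cdot$,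 $x$ and $z$ do not occur in $B\cdot$, and $x,y,z$ do not occur in the context $S\{\cdot\}$. A derivation $\Phi$ from $A$ to $B$ is a finite (possibly empty) sequence of such steps; it is *rectified* if every line, including $A$ and $B$, is rectified. Each step with premise $Q$ and conclusion $P$ induces a map from the vertices of $\mathcal G(Q)$ to those of $\mathcal G(P)$ that tracks occurrences of atoms and quantifiers. It is the identity for $\mathsf m$ and $\equiv$ (for $\equiv$, each occurrence is followed along a chosen sequence of applications of the generating equations), the canonical injection for $\mathsf w$ and $\mathsf w_\forall$, it merges the two atoms for $\mathsf{ac}$, and it merges the two displayed quantifiers of the premise into the displayed one of the conclusion for $\hat{\mathsf c}_\forall,\hat{\mathsf m}_\forall,\hat{\mathsf m}_\exists$; everything else is kept. The induced map $\lceil\Phi\rceil$ is the composition of the maps induced by the steps. **Claim.** Let $\Phi$ be a rectified derivation from $A$ to $B$ in $\{\mathsf w,\mathsf w_\forall,\mathsf{ac},\hat{\mathsf c}_\forall,\mathsf m,\hat{\mathsf m}_\forall,\hat{\mathsf m}_\exists,\equiv\}$. Then $\mathcal G(A)$ and $\mathcal G(B)$ are fographs and the induced map $\lceil\Phi\rceil:\mathcal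 G(A)\to\mathcal G(B)$ is a skew bifibration. -/

import Mathlib

universe u v w

namespace FOGraph

section Formulas

/-- Atoms over the language `L` with variables in `α`: the truth constants, `p(t₁,…,tₙ)` and
`p̄(t₁,…,tₙ)`, where `p̄` is the dual of the predicate symbol `p`. -/
inductive Atom (L : FirstOrder.Language.{u, v}) (α : Type w) : Type (max u v w)
  | tt : Atom L α
  | ff : Atom L α
  | pred {n : ℕ} (p : L.Relations n) (ts : Fin n → L.Term α) : Atom L α
  | dualPred {n : ℕ} (p : L.Relations n) (ts : Fin n → L.Term α) : Atom L α

/-- First-order formulas in negation normal form, with named bound variables. -/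
inductive Form (L : FirstOrder.Language.{u, v}) (α : Type w) : Type (max u v w)
  | atom (a : Atom L α) : Form L α
  | and (A B : Form L α) : Form L α
  | or (A B : Form L α) : Form L α
  | ex (x : α) (A : Form L α) : Form L α
  | all (x : α) (A : Form L α) : Form L α

variable {L : FirstOrder.Language.{u, v}} {α : Type w}

/-- Simultaneous replacement of every variable `x` in an atom by the variable `ρ x`. -/
def Atom.rename (ρ : α → α) : Atom L α → Atom L α
  | .tt => .tt
  | .ff => .ff
  | .pred p ts => .pred p fun i => (ts i).relabel ρ
  | .dualPred p ts => .dualPred p fun i => (ts i).relabel ρ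

/-- The set of variables occurring in an atom. -/
def Atom.vars [DecidableEq α] : Atom L α → Finset α
  | .tt => ∅
  | .ff => ∅
  | .pred _ ts => Finset.univ.biUnion fun i => (ts i).varFinset
  | .dualPred _ ts => Finset.univ.biUnion fun i => (ts i).varFinset

namespace Form

/-- Replacement of every occurrence of every variable `x` by `ρ x`. -/
def rename (ρ : α → α) : Form L α → Form L α
  | atom a => atom (a.rename ρ)
  | and A B => and (rename ρ A) (rename ρ B)
  | or A B => or (rename ρ A) (rename ρ B)
  | ex x A => ex (ρ x) (rename ρ A)
  | all x A => all (ρ x) (rename ρ A)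

/-- All variables occurring in a formula: free, bound, or attached to a quantifier. -/
def vars [DecidableEq α] : Form L α → Finset α
  | atom a => a.vars
  | and A B => vars A ∪ vars B
  | or A B => vars A ∪ vars B
  | ex x A => insert x (vars A)
  | all x A => insert x (vars A)

/-- The free variables of a formula. -/
def freeVars [DecidableEq α] : Form L α → Finset α
  | atom a => a.vars
  | and A B => freeVars A ∪ freeVars B
  | or A B => freeVars A ∪ freeVars B
  | ex x A => (freeVars A).erase x
  | all x A => (freeVars A).erase x

/-- The bound variables of a formula, one entry for each quantifier occurrence. -/
def boundVars : Form L α → List α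
  | atom _ => []
  | and A B => boundVars A ++ boundVars B
  | or A B => boundVars A ++ boundVars B
  | ex x A => x :: boundVars A
  | all x A => x :: boundVars A

/-- A formula is rectified if all bound variables are distinct from one another and from all free
variables. -/
def Rectified [DecidableEq α] (A : Form L α) : Prop :=
  A.boundVars.Nodup ∧ ∀ x ∈ A.boundVars, x ∉ A.freeVars

end Form

end Formulas

section Graphs

/-- A finite simple graph whose vertices carry labels in `Λ`. -/
structure LGraph (Λ : Type u) where
  V : Type
  finite : Finite V
  graph : SimpleGraph V
  label : V → Λ

/-- The one-vertex graph with label `l`. -/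
def LGraph.single {Λ : Type u} (l : Λ) : LGraph Λ where
  V := Unit
  finite := inferInstance
  graph := ⊥
  label := fun _ => l

/-- The disjoint union `G + H`. -/
def LGraph.union {Λ : Type u} (G H : LGraph Λ) : LGraph Λ where
  V := G.V ⊕ H.V
  finite := by
    have := G.finite
    have := H.finite
    infer_instance
  graph := G.graph ⊕g H.graph
  label := Sum.elim G.label H.label

/-- The join `G × H`: the disjoint union with all edges between `G` and `H` added. -/
def LGraph.join {Λ : Type u} (G H : LGraph Λ) : LGraph Λ where
  V := G.V ⊕ H.V
  finite := by
    have := G.finite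
    have := H.finite
    infer_instance
  graph := (G.graph ⊕g H.graph) ⊔ completeBipartiteGraph G.V H.V
  label := Sum.elim G.label H.label

/-- A graph is a cograph if it has no induced path on four vertices. -/
def IsCograph {V : Type} (G : SimpleGraph V) : Prop :=
  IsEmpty (SimpleGraph.pathGraph 4 ↪g G)

/-- A module: all its vertices have the same neighbours outside of it. -/
def IsGraphModule {V : Type} (G : SimpleGraph V) (M : Set V) : Prop :=
  ∀ v ∈ M, ∀ w ∈ M, G.neighborSet v \ M = G.neighborSet w \ M

/-- A module is strong if it is comparable to, or disjoint from, every other module. -/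
def IsStrongModule {V : Type} (G : SimpleGraph V) (M : Set V) : Prop :=
  IsGraphModule G M ∧ ∀ M' : Set V, IsGraphModule G M' → M' ⊆ M ∨ M ⊆ M' ∨ M ∩ M' = ∅

/-- The scope of `b`: the smallest proper strong module containing `b`, where a module is proper if
it has at least two vertices. Strong modules containing `b` form a chain, so that in a finite graph
with at least two vertices this intersection is itself the smallest one. -/
def scope {V : Type} (G : SimpleGraph V) (b : V) : Set V :=
  ⋂₀ {M | IsStrongModule G M ∧ M.Nontrivial ∧ b ∈ M}

/-- Labels of the vertices of a logical graph: atoms and variables. -/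
inductive Label (L : FirstOrder.Language.{u, v}) (α : Type w) : Type (max u v w)
  | lit (a : Atom L α) : Label L α
  | binder (x : α) : Label L α

variable {L : FirstOrder.Language.{u, v}} {α : Type w}

/-- Application of a variable renaming to a label. -/
def Label.rename (ρ : α → α) : Label L α → Label L α
  | .lit a => .lit (a.rename ρ)
  | .binder x => .binder (ρ x)

/-- The variables occurring in a label. -/
def Label.vars [DecidableEq α] : Label L α → Finset α
  | .lit a => a.vars
  | .binder x => {x}

namespace LGraph

/-- A literal is an atom-labelled vertex. -/
def IsLiteral (G : LGraph (Label L α)) (l : G.V) : Prop := ∃ a, G.label l = .lit a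

/-- An `x`-binder is a vertex labelled by the variable `x`. -/
def IsBinderOf (G : LGraph (Label L α)) (x : α) (b : G.V) : Prop := G.label b = .binder x

/-- A binder is a variable-labelled vertex. -/
def IsBinder (G : LGraph (Label L α)) (b : G.V) : Prop := ∃ x, G.IsBinderOf x b

/-- A binder is existential if it is adjacent to every other vertex in its scope. -/
def IsExistential (G : LGraph (Label L α)) (b : G.V) : Prop :=
  G.IsBinder b ∧ ∀ c ∈ scope G.graph b, c ≠ b → G.graph.Adj b c

/-- An `x`-binder is legal if its scope contains no other `x`-binder and at least one literal. -/
def IsLegal (G : LGraph (Label L α)) (x : α) (b : G.V) : Prop :=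
  (∀ c ∈ scope G.graph b, G.IsBinderOf x c → c = b) ∧ ∃ l ∈ scope G.graph b, G.IsLiteral l

/-- A fograph: a cograph, labelled by atoms and variables, with at least one literal and all of whose
binders are legal. -/
def IsFograph (G : LGraph (Label L α)) : Prop :=
  IsCograph G.graph ∧ (∃ l, G.IsLiteral l) ∧ ∀ x b, G.IsBinderOf x b → G.IsLegal x b

/-- The binding graph: an edge goes from an `x`-binder to each literal in its scope whose atom
contains `x`. -/
def bindingGraph [DecidableEq α] (G : LGraph (Label L α)) : Digraph G.V where
  Adj b l := ∃ x a, G.IsBinderOf x b ∧ G.label l = .lit a ∧ x ∈ a.vars ∧ l ∈ scope G.graph b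

end LGraph

/-- A homomorphism of graphs, as a property of a map on vertices. -/
def IsGraphHom {V W : Type} (G : SimpleGraph V) (H : SimpleGraph W) (φ : V → W) : Prop :=
  ∀ v w, G.Adj v w → H.Adj (φ v) (φ w)

/-- A skew fibration of graphs. -/
def IsSkewFibration {V W : Type} (G : SimpleGraph V) (H : SimpleGraph W) (φ : V → W) : Prop :=
  IsGraphHom G H φ ∧
    ∀ v w, H.Adj w (φ v) → ∃ w' : V, G.Adj w' v ∧ ¬ H.Adj (φ w') w

/-- A fibration of directed graphs. -/
def IsDigraphFibration {V W : Type} (G : Digraph V) (H : Digraph W) (φ : V → W) : Prop :=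
  (∀ v w, G.Adj v w → H.Adj (φ v) (φ w)) ∧
    ∀ v w, H.Adj w (φ v) → ∃! w' : V, G.Adj w' v ∧ φ w' = w

/-- The pair `(φ, ρ)` is a fograph homomorphism: `φ` is a graph homomorphism and `ρ` is a variable
renaming (the identity almost everywhere), which is the identity on the variables that do not occur
in `G` and relates the labels of `v` and `φ v`. -/
def IsFographHom [DecidableEq α] (G H : LGraph (Label L α)) (φ : G.V → H.V) (ρ : α → α) : Prop :=
  IsGraphHom G.graph H.graph φ ∧ {x | ρ x ≠ x}.Finite ∧
    (∀ v, H.label (φ v) = (G.label v).rename ρ) ∧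
    ∀ x, (∀ v, x ∉ (G.label v).vars) → ρ x = x

/-- `φ` preserves existentials. -/
def PreservesExistentials (G H : LGraph (Label L α)) (φ : G.V → H.V) : Prop :=
  ∀ b, G.IsExistential b → H.IsExistential (φ b)

/-- A skew bifibration between fographs: an existential-preserving fograph homomorphism which is a
skew fibration on the graphs and a fibration on the binding graphs. -/
structure IsSkewBifibration [DecidableEq α] (G H : LGraph (Label L α)) (φ : G.V → H.V) : Prop where
  source : G.IsFograph
  target : H.IsFograph
  hom : ∃ ρ : α → α, IsFographHom G H φ ρ
  existentials : PreservesExistentials G H φ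
  skew : IsSkewFibration G.graph H.graph φ
  binding : IsDigraphFibration G.bindingGraph H.bindingGraph φ

/-- The graph `G(A)` of a formula `A`. -/
def graphOf : Form L α → LGraph (Label L α)
  | .atom a => .single (.lit a)
  | .and A B => .join (graphOf A) (graphOf B)
  | .or A B => .union (graphOf A) (graphOf B)
  | .ex x A => .join (.single (.binder x)) (graphOf A)
  | .all x A => .union (.single (.binder x)) (graphOf A)

/-- The vertices of `G(A)`. -/
abbrev Vert (A : Form L α) : Type := (graphOf A).V

/-- The vertex of the renamed formula that corresponds to a given vertex. -/
def renameVert (ρ : α → α) : (A : Form L α) → Vert A → Vert (A.rename ρ)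
  | .atom _ => fun v => v
  | .and A B => Sum.map (renameVert ρ A) (renameVert ρ B)
  | .or A B => Sum.map (renameVert ρ A) (renameVert ρ B)
  | .ex _ A => Sum.map id (renameVert ρ A)
  | .all _ A => Sum.map id (renameVert ρ A)

end Graphs

section Rules

variable {L : FirstOrder.Language.{u, v}} {α : Type w} [DecidableEq α]

/-- Witnesses of the equivalence `≡`, the congruence generated by associativity and commutativity of
both connectives, the exchange of equal quantifiers and the scope extension laws. The witness records
which occurrences are moved where. -/
inductive Equivalence : Form L α → Form L α → Type (max u v w)
  | refl (A) : Equivalence A A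
  | symm {A B} (e : Equivalence A B) : Equivalence B A
  | trans {A B C} (e : Equivalence A B) (f : Equivalence B C) : Equivalence A C
  | andCongr {A A' B B'} (e : Equivalence A A') (f : Equivalence B B') :
      Equivalence (.and A B) (.and A' B')
  | orCongr {A A' B B'} (e : Equivalence A A') (f : Equivalence B B') :
      Equivalence (.or A B) (.or A' B')
  | exCongr (x) {A A'} (e : Equivalence A A') : Equivalence (.ex x A) (.ex x A')
  | allCongr (x) {A A'} (e : Equivalence A A') : Equivalence (.all x A) (.all x A')
  | andComm (A B) : Equivalence (.and A B) (.and B A)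
  | andAssoc (A B C) : Equivalence (.and (.and A B) C) (.and A (.and B C))
  | orComm (A B) : Equivalence (.or A B) (.or B A)
  | orAssoc (A B C) : Equivalence (.or (.or A B) C) (.or A (.or B C))
  | allAll (x y A) : Equivalence (.all x (.all y A)) (.all y (.all x A))
  | allOr (x A B) (h : x ∉ B.freeVars) : Equivalence (.all x (.or A B)) (.or (.all x A) B)
  | exEx (x y A) : Equivalence (.ex x (.ex y A)) (.ex y (.ex x A))
  | exAnd (x A B) (h : x ∉ B.freeVars) : Equivalence (.ex x (.and A B)) (.and (.ex x A) B)

/-- The bijection `X ⊕ (Y ⊕ Z) ≃ Y ⊕ (X ⊕ Z)` that exchanges the first two summands. -/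
def sumLeftComm (X Y Z : Type) : X ⊕ (Y ⊕ Z) ≃ Y ⊕ (X ⊕ Z) :=
  (Equiv.sumAssoc X Y Z).symm.trans
    (((Equiv.sumComm X Y).sumCongr (Equiv.refl Z)).trans (Equiv.sumAssoc Y X Z))

/-- The identification of the vertices of `G(A)` and `G(B)` given by a witness of `A ≡ B`: every
occurrence of an atom or quantifier is sent to the same occurrence at its new place. -/
def Equivalence.toEquiv : {A B : Form L α} → Equivalence A B → (Vert A ≃ Vert B)
  | _, _, .refl _ => Equiv.refl _
  | _, _, .symm e => (toEquiv e).symm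
  | _, _, .trans e f => (toEquiv e).trans (toEquiv f)
  | _, _, .andCongr e f => (toEquiv e).sumCongr (toEquiv f)
  | _, _, .orCongr e f => (toEquiv e).sumCongr (toEquiv f)
  | _, _, .exCongr _ e => (Equiv.refl Unit).sumCongr (toEquiv e)
  | _, _, .allCongr _ e => (Equiv.refl Unit).sumCongr (toEquiv e)
  | _, _, .andComm A B => Equiv.sumComm (Vert A) (Vert B)
  | _, _, .andAssoc A B C => Equiv.sumAssoc (Vert A) (Vert B) (Vert C)
  | _, _, .orComm A B => Equiv.sumComm (Vert A) (Vert B)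
  | _, _, .orAssoc A B C => Equiv.sumAssoc (Vert A) (Vert B) (Vert C)
  | _, _, .allAll _ _ A => sumLeftComm Unit Unit (Vert A)
  | _, _, .allOr _ A B _ => (Equiv.sumAssoc Unit (Vert A) (Vert B)).symm
  | _, _, .exEx _ _ A => sumLeftComm Unit Unit (Vert A)
  | _, _, .exAnd _ A B _ => (Equiv.sumAssoc Unit (Vert A) (Vert B)).symm

/-- The formula `Ax`, obtained from `Ay` by putting `x` for `y`. -/
def Form.replace (A : Form L α) (y x : α) : Form L α := A.rename (Function.update id y x)

/-- The condition that `x` does not occur in `A·`, the formula `Ay` with a placeholder at all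
occurrences of `y`. -/
def NotInPlaceholder (x y : α) (Ay : Form L α) : Prop := x = y ∨ x ∉ Ay.vars

/-- The inference rules, without their context; `Rule Q P` has premise `Q` and conclusion `P`.
* `weak`: from `A` infer `A ∨ B`;
* `weakAll`: from `A` infer `∀x.A`, if `x` is not free in `A`;
* `atomContr`: from `a ∨ a` infer `a`, for an atom `a`;
* `contrAll`: from `∀y.∀x.Ax` infer `∀x.Ax`;
* `medial`: from `(A ∧ C) ∨ (B ∧ D)` infer `(A ∨ B) ∧ (C ∨ D)`;
* `medialAll`: from `(∀y.Ay) ∨ (∀z.Bz)` infer `∀x.(Ax ∨ Bx)`;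
* `medialEx`: from `(∃y.Ay) ∨ (∃z.Bz)` infer `∃x.(Ax ∨ Bx)`;
* `equiv`: from `A` infer `B`, if `A ≡ B`. -/
inductive Rule : Form L α → Form L α → Type (max u v w)
  | weak (A B) : Rule A (.or A B)
  | weakAll (x A) (h : x ∉ A.freeVars) : Rule A (.all x A)
  | atomContr (a) : Rule (.or (.atom a) (.atom a)) (.atom a)
  | contrAll (y x A) (h : NotInPlaceholder y x A) : Rule (.all y (.all x A)) (.all x A)
  | medial (A B C D) :
      Rule (.or (.and A C) (.and B D)) (.and (.or A B) (.or C D))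
  | medialAll (x y z A B) (hA : NotInPlaceholder x y A) (hB : NotInPlaceholder x z B) :
      Rule (.or (.all y A) (.all z B)) (.all x (.or (A.replace y x) (B.replace z x)))
  | medialEx (x y z A B) (hA : NotInPlaceholder x y A) (hB : NotInPlaceholder x z B) :
      Rule (.or (.ex y A) (.ex z B)) (.ex x (.or (A.replace y x) (B.replace z x)))
  | equiv {A B} (e : Equivalence A B) : Rule A B

/-- The variables that a rule instance requires not to occur in its context. -/
def Rule.fresh : {Q P : Form L α} → Rule Q P → Finset α
  | _, _, .contrAll y x _ _ => {x, y}
  | _, _, .medialAll x y z _ _ _ _ => {x, y, z}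
  | _, _, .medialEx x y z _ _ _ _ => {x, y, z}
  | _, _, _ => ∅

/-- The map `(1 + X) + (1 + Y) → 1 + (X' + Y')` that merges the two extra points. -/
def mergeMap {X Y X' Y' : Type} (f : X → X') (g : Y → Y') :
    (Unit ⊕ X) ⊕ (Unit ⊕ Y) → Unit ⊕ (X' ⊕ Y')
  | .inl (.inl _) => .inl ()
  | .inl (.inr p) => .inr (.inl (f p))
  | .inr (.inl _) => .inl ()
  | .inr (.inr q) => .inr (.inr (g q))

/-- The induced map of a rule instance, on the vertices of the graphs of premise and conclusion. -/
def Rule.map : {Q P : Form L α} → Rule Q P → Vert Q → Vert P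
  | _, _, .weak A B => (Sum.inl : Vert A → Vert A ⊕ Vert B)
  | _, _, .weakAll _ A _ => (Sum.inr : Vert A → Unit ⊕ Vert A)
  | _, _, .atomContr _ => fun _ => ()
  | _, _, .contrAll _ _ A _ =>
      (Sum.elim Sum.inl id : Unit ⊕ (Unit ⊕ Vert A) → Unit ⊕ Vert A)
  | _, _, .medial A B C D =>
      (Equiv.sumSumSumComm (Vert A) (Vert C) (Vert B) (Vert D) :
        (Vert A ⊕ Vert C) ⊕ (Vert B ⊕ Vert D) → (Vert A ⊕ Vert B) ⊕ (Vert C ⊕ Vert D))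
  | _, _, .medialAll x y z A B _ _ =>
      mergeMap (renameVert (Function.update id y x) A) (renameVert (Function.update id z x) B)
  | _, _, .medialEx x y z A B _ _ =>
      mergeMap (renameVert (Function.update id y x) A) (renameVert (Function.update id z x) B)
  | _, _, .equiv e => e.toEquiv

/-- (Positive) contexts: formulas with exactly one hole in the position of an atom. -/
inductive Ctx (L : FirstOrder.Language.{u, v}) (α : Type w) : Type (max u v w)
  | hole : Ctx L α
  | andLeft (S : Ctx L α) (B : Form L α) : Ctx L α
  | andRight (B : Form L α) (S : Ctx L α) : Ctx L α
  | orLeft (S : Ctx L α) (B : Form L α) : Ctx L α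
  | orRight (B : Form L α) (S : Ctx L α) : Ctx L α
  | ex (x : α) (S : Ctx L α) : Ctx L α
  | all (x : α) (S : Ctx L α) : Ctx L α

/-- The formula `S{A}`, the context `S` with the hole replaced by `A`. -/
def Ctx.fill : Ctx L α → Form L α → Form L α
  | .hole, A => A
  | .andLeft S B, A => .and (S.fill A) B
  | .andRight B S, A => .and B (S.fill A)
  | .orLeft S B, A => .or (S.fill A) B
  | .orRight B S, A => .or B (S.fill A)
  | .ex x S, A => .ex x (S.fill A)
  | .all x S, A => .all x (S.fill A)

/-- The variables occurring in a context. -/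
def Ctx.vars : Ctx L α → Finset α
  | .hole => ∅
  | .andLeft S B => S.vars ∪ B.vars
  | .andRight B S => B.vars ∪ S.vars
  | .orLeft S B => S.vars ∪ B.vars
  | .orRight B S => B.vars ∪ S.vars
  | .ex x S => insert x S.vars
  | .all x S => insert x S.vars

/-- Extension of a map on the vertices of the formula in the hole by the identity on the context. -/
def Ctx.map {Q P : Form L α} (f : Vert Q → Vert P) :
    (S : Ctx L α) → Vert (S.fill Q) → Vert (S.fill P)
  | .hole => f
  | .andLeft S _ => Sum.map (Ctx.map f S) id
  | .andRight _ S => Sum.map id (Ctx.map f S)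
  | .orLeft S _ => Sum.map (Ctx.map f S) id
  | .orRight _ S => Sum.map id (Ctx.map f S)
  | .ex _ S => Sum.map id (Ctx.map f S)
  | .all _ S => Sum.map id (Ctx.map f S)

/-- Inference steps: rule instances inside a context. -/
inductive Step : Form L α → Form L α → Type (max u v w)
  | mk (S : Ctx L α) {Q P : Form L α} (r : Rule Q P) (h : ∀ x ∈ r.fresh, x ∉ S.vars) :
      Step (S.fill Q) (S.fill P)

/-- The induced map of an inference step. -/
def Step.map : {A B : Form L α} → Step A B → Vert A → Vert B
  | _, _, .mk S r _ => S.map r.map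

/-- `Derivation A B` is the type of derivations from `A` (premise) to `B` (conclusion). -/
inductive Derivation : Form L α → Form L α → Type (max u v w)
  | nil (A) : Derivation A A
  | snoc {A B C} (Φ : Derivation A B) (s : Step B C) : Derivation A C

/-- A derivation is rectified if every line of it is. -/
def Derivation.Rectified : {A B : Form L α} → Derivation A B → Prop
  | _, _, .nil A => A.Rectified
  | _, _, .snoc (C := C) Φ _ => Derivation.Rectified Φ ∧ C.Rectified

/-- The induced map of a derivation, the composition of the induced maps of its steps. -/
def Derivation.map : {A B : Form L α} → Derivation A B → Vert A → Vert B
  | _, _, .nil _ => id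
  | _, _, .snoc Φ s => s.map ∘ Derivation.map Φ

end Rules

end FOGraph

namespace FOGraph

/-! ### Strong modules and scopes under embeddings of graphs -/

section Modules

variable {V W : Type} {G : SimpleGraph V} {H : SimpleGraph W}

/-! Each condition on the induced map is reduced to a property that is easy to check rule by rule
and that survives contexts and composition.

The skew fibration property is strengthened to `PreservesMaxCliques`: a homomorphism sending maximal
cliques to maximal cliques. This passes through disjoint unions, joins and composition, holds for
every rule, and implies the lifting property. Indeed, choose a maximal clique containing `v`; if
every neighbour of `v` mapped to a neighbour of `w`, then `w` would be adjacent to the whole image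
clique, hence lie in it by maximality, and so be adjacent to itself.

For existentials, scopes are never computed in full. They can only grow when a graph is embedded as
a module, so a non-neighbour in the scope of a universal quantifier stays there. Conversely, the
vertex of an existential quantifier keeps some strong module that it dominates, which bounds its
scope from above. Thus the existential binders of a formula's graph are exactly its existential
quantifiers (`isExistential_graphOf_iff`), and these are tracked syntactically.

For binding, rectification makes scopes irrelevant: an `x`-binder binds precisely the literals that
contain `x`. Each step preserves labels up to a renaming that is injective on the variables of each
atom and keeps free variables free. This suffices for a fibration (`isDigraphFibration_of_rename`),
and fibrations compose. -/

theorem isGraphModule_iff {M : Set V} :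
    IsGraphModule G M ↔ ∀ v ∈ M, ∀ w ∈ M, ∀ u ∉ M, G.Adj v u → G.Adj w u := by
  constructor
  · intro h v hv w hw u hu hvu
    have : u ∈ G.neighborSet v \ M := ⟨hvu, hu⟩
    rw [h v hv w hw] at this
    exact this.1
  · intro h v hv w hw
    ext u
    exact ⟨fun hu => ⟨h v hv w hw u hu.2 hu.1, hu.2⟩, fun hu => ⟨h w hw v hv u hu.2 hu.1, hu.2⟩⟩

theorem isStrongModule_univ : IsStrongModule G Set.univ :=
  ⟨isGraphModule_iff.2 fun _ _ _ _ _ hu => absurd trivial hu, fun _ _ => .inl (Set.subset_univ _)⟩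

theorem IsGraphModule.image {M : Set V} (hM : IsGraphModule G M) (f : G ↪g H)
    (hf : IsGraphModule H (Set.range f)) : IsGraphModule H (f '' M) := by
  rw [isGraphModule_iff] at *
  rintro _ ⟨v, hv, rfl⟩ _ ⟨w, hw, rfl⟩ u hu hvu
  by_cases h : u ∈ Set.range f
  · obtain ⟨u, rfl⟩ := h
    rw [f.map_adj_iff] at hvu ⊢
    exact hM v hv w hw u (fun h => hu ⟨u, h, rfl⟩) hvu
  · exact hf _ ⟨v, rfl⟩ _ ⟨w, rfl⟩ u h hvu

theorem IsGraphModule.preimage (f : G ↪g H) {M : Set W} (hM : IsGraphModule H M) :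
    IsGraphModule G (f ⁻¹' M) := by
  rw [isGraphModule_iff] at *
  intro v hv w hw u hu hvu
  rw [← f.map_adj_iff] at hvu ⊢
  exact hM _ hv _ hw _ hu hvu

/-- Modules of `G` become modules of `H` because the image of `f` is itself a module; comparing them
with `S` in `H` and pulling back gives strength in `G`. -/
theorem IsStrongModule.preimage (f : G ↪g H) (hf : IsGraphModule H (Set.range f)) {S : Set W}
    (hS : IsStrongModule H S) : IsStrongModule G (f ⁻¹' S) := by
  refine ⟨hS.1.preimage f, fun M hM => ?_⟩
  rcases hS.2 _ (hM.image f hf) with h | h | h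
  · exact .inl (Set.image_subset_iff.1 h)
  · refine .inr (.inl fun v hv => ?_)
    obtain ⟨w, hw, e⟩ := h hv
    exact f.injective e ▸ hw
  · refine .inr (.inr (Set.eq_empty_iff_forall_notMem.2 fun v hv => ?_))
    exact (Set.eq_empty_iff_forall_notMem.1 h) (f v) ⟨hv.1, v, hv.2, rfl⟩

/-- Scopes can only grow when a graph is embedded as a module. -/
theorem map_mem_scope (f : G ↪g H) (hf : IsGraphModule H (Set.range f)) {b c : V}
    (h : c ∈ scope G b) : f c ∈ scope H (f b) := by
  rintro S ⟨hS, hS2, hb⟩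
  -- If the pullback is a single vertex it is not a competitor for the scope in `G`. Then `S` must
  -- leave the image of `f`, and, being strong and meeting that module, it contains it.
  by_cases h2 : (f ⁻¹' S).Nontrivial
  · exact h _ ⟨hS.preimage f hf, h2, hb⟩
  · rcases hS.2 _ hf with h3 | h3 | h3
    · exact h3 ⟨c, rfl⟩
    · refine absurd ?_ h2
      obtain ⟨x, hx, y, hy, hxy⟩ := hS2
      obtain ⟨x, rfl⟩ := h3 hx
      obtain ⟨y, rfl⟩ := h3 hy
      exact ⟨x, hx, y, hy, fun e => hxy (congrArg f e)⟩
    · exact absurd (show f b ∈ S ∩ Set.range f from ⟨hb, b, rfl⟩) (h3 ▸ Set.notMem_empty _)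

theorem isGraphModule_range_of_not_adj {f : V → W} (hf : ∀ u, ∀ w ∉ Set.range f, ¬ H.Adj (f u) w) :
    IsGraphModule H (Set.range f) := by
  rw [isGraphModule_iff]
  rintro _ ⟨v, rfl⟩ _ ⟨w, rfl⟩ u hu h
  exact absurd h (hf _ _ hu)

theorem isGraphModule_range_of_adj {f : V → W} (hf : ∀ u, ∀ w ∉ Set.range f, H.Adj (f u) w) :
    IsGraphModule H (Set.range f) := by
  rw [isGraphModule_iff]
  rintro _ ⟨v, rfl⟩ _ ⟨w, rfl⟩ u hu _
  exact hf _ _ hu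

/-- Some proper strong module contains `b`, with `b` adjacent to everything else in it. -/
def DominatesStrongModule (G : SimpleGraph V) (b : V) : Prop :=
  ∃ M, IsStrongModule G M ∧ M.Nontrivial ∧ b ∈ M ∧ ∀ c ∈ M, c ≠ b → G.Adj b c

theorem DominatesStrongModule.adj_of_mem_scope {b c : V} (h : DominatesStrongModule G b)
    (hc : c ∈ scope G b) (hcb : c ≠ b) : G.Adj b c := by
  obtain ⟨M, h1, h2, h3, h4⟩ := h
  exact h4 c (hc M ⟨h1, h2, h3⟩) hcb

/-- The image of `M` stays strong because `M` is connected through `b`: a module reaching outside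
the image of `f` is closed under adjacency inside it, so it contains the image of `M` or misses it.
-/
theorem DominatesStrongModule.map_of_not_adj {b : V} (hb : DominatesStrongModule G b) (f : G ↪g H)
    (hf : ∀ u, ∀ w ∉ Set.range f, ¬ H.Adj (f u) w) : DominatesStrongModule H (f b) := by
  obtain ⟨M, h1, h2, h3, h4⟩ := hb
  refine ⟨f '' M, ⟨h1.1.image f (isGraphModule_range_of_not_adj hf), fun M' hM' => ?_⟩,
    h2.image f.injective, ⟨b, h3, rfl⟩, ?_⟩
  · rcases h1.2 _ (hM'.preimage f) with h | h | h
    · by_cases h5 : M' ⊆ Set.range f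
      · left
        intro w hw
        obtain ⟨v, rfl⟩ := h5 hw
        exact ⟨v, h hw, rfl⟩
      · obtain ⟨w, hw, hwf⟩ := Set.not_subset.1 h5
        -- An edge leaving `M'` from `f u` would force `w` to be adjacent to `f u'`, although `w`
        -- sees nothing in the image.
        have closed : ∀ u u', f u ∈ M' → G.Adj u u' → f u' ∈ M' := by
          intro u u' hu huu
          by_contra hn
          exact hf u' w hwf
            (isGraphModule_iff.1 hM' _ hu _ hw _ hn ((f.map_adj_iff).2 huu)).symm
        by_cases h6 : ∃ u ∈ M, f u ∈ M'
        · obtain ⟨u, hu, huM⟩ := h6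
          have hbM : f b ∈ M' := by
            by_cases e : u = b
            · exact e ▸ huM
            · exact closed u b huM (h4 u hu e).symm
          right; left
          rintro _ ⟨c, hc, rfl⟩
          by_cases e : c = b
          · exact e ▸ hbM
          · exact closed b c hbM (h4 c hc e)
        · right; right
          rw [Set.eq_empty_iff_forall_notMem]
          rintro _ ⟨⟨u, hu, rfl⟩, h7⟩
          exact h6 ⟨u, hu, h7⟩
    · exact .inr (.inl (Set.image_subset_iff.2 h))
    · right; right
      rw [Set.eq_empty_iff_forall_notMem] at h ⊢
      rintro _ ⟨⟨u, hu, rfl⟩, h7⟩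
      exact h u ⟨hu, h7⟩
  · rintro _ ⟨c, hc, rfl⟩ hcb
    exact (f.map_adj_iff).2 (h4 c hc fun e => hcb (congrArg f e))

/-- The image of `M` may cease to be strong, but only when `b` dominates all of `G`; then `b`
dominates all of `H` and the whole graph serves instead. Otherwise a non-neighbour of `b` separates
the image of `M` from modules that would overlap it. -/
theorem DominatesStrongModule.map_of_adj {b : V} (hb : DominatesStrongModule G b) (f : G ↪g H)
    (hf : ∀ u, ∀ w ∉ Set.range f, H.Adj (f u) w) : DominatesStrongModule H (f b) := by
  obtain ⟨M, h1, h2, h3, h4⟩ := hb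
  by_cases hd : ∀ d, d ≠ b → G.Adj b d
  · refine ⟨Set.univ, isStrongModule_univ, (h2.image f.injective).mono (Set.subset_univ _),
      trivial, fun c _ hc => ?_⟩
    by_cases h : c ∈ Set.range f
    · obtain ⟨c, rfl⟩ := h
      exact (f.map_adj_iff).2 (hd c fun e => hc (congrArg f e))
    · exact hf b c h
  push Not at hd
  obtain ⟨d, hdb, hd⟩ := hd
  have hdM : d ∉ M := fun h => hd (h4 d h hdb)
  refine ⟨f '' M, ⟨h1.1.image f (isGraphModule_range_of_adj hf), fun M' hM' => ?_⟩,
    h2.image f.injective, ⟨b, h3, rfl⟩, ?_⟩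
  · rcases h1.2 _ (hM'.preimage f) with h | h | h
    · by_cases h5 : M' ⊆ Set.range f
      · left
        intro w hw
        obtain ⟨v, rfl⟩ := h5 hw
        exact ⟨v, h hw, rfl⟩
      · obtain ⟨w, hw, hwf⟩ := Set.not_subset.1 h5
        right; right
        rw [Set.eq_empty_iff_forall_notMem]
        rintro _ ⟨⟨u, hu, rfl⟩, h7⟩
        have hdM' : f d ∉ M' := fun h8 => hdM (h h8)
        -- The vertex `w` outside the image sees `f d`, so the module `M'` transfers this to `f u`,
        -- and the module `M` then transfers it to `b`, a contradiction.
        have := isGraphModule_iff.1 hM' _ hw _ h7 _ hdM' (hf d w hwf).symm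
        exact hd (isGraphModule_iff.1 h1.1 _ hu _ h3 _ hdM ((f.map_adj_iff).1 this))
    · exact .inr (.inl (Set.image_subset_iff.2 h))
    · right; right
      rw [Set.eq_empty_iff_forall_notMem] at h ⊢
      rintro _ ⟨⟨u, hu, rfl⟩, h7⟩
      exact h u ⟨hu, h7⟩
  · rintro _ ⟨c, hc, rfl⟩ hcb
    exact (f.map_adj_iff).2 (h4 c hc fun e => hcb (congrArg f e))

/-- If the complement of a vertex `b` is a module, the scope of `b` is the whole graph. -/
theorem mem_scope_of_isGraphModule_compl {b : V} (h : IsGraphModule G {b}ᶜ) (c : V) :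
    c ∈ scope G b := by
  rintro S ⟨hS, hS2, hb⟩
  by_cases e : c = b
  · exact e ▸ hb
  rcases hS.2 _ h with h3 | h3 | h3
  · exact h3 e
  · exact absurd rfl (h3 hb)
  · obtain ⟨x, hx, hxb⟩ := hS2.exists_ne b
    exact absurd (show x ∈ S ∩ {b}ᶜ from ⟨hx, hxb⟩) (h3 ▸ Set.notMem_empty _)

end Modules

/-! ### Disjoint unions, joins and cographs -/

section SumsAndJoins

variable {V W : Type} (G : SimpleGraph V) (H : SimpleGraph W)

/-- The join of two graphs. -/
abbrev joinGraph : SimpleGraph (V ⊕ W) := (G ⊕g H) ⊔ completeBipartiteGraph V W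

variable {G H}

@[simp] theorem joinGraph_adj_inl_inl {u v : V} :
    (joinGraph G H).Adj (.inl u) (.inl v) ↔ G.Adj u v := by simp [joinGraph]
@[simp] theorem joinGraph_adj_inr_inr {u v : W} :
    (joinGraph G H).Adj (.inr u) (.inr v) ↔ H.Adj u v := by simp [joinGraph]
@[simp] theorem joinGraph_adj_inl_inr {u : V} {v : W} :
    (joinGraph G H).Adj (.inl u) (.inr v) := by simp [joinGraph]
@[simp] theorem joinGraph_adj_inr_inl {u : V} {v : W} :
    (joinGraph G H).Adj (.inr v) (.inl u) := by simp [joinGraph]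

/-- The left injection into a disjoint union. -/
def sumInl : G ↪g (G ⊕g H) := ⟨⟨.inl, Sum.inl_injective⟩, by simp⟩
/-- The right injection into a disjoint union. -/
def sumInr : H ↪g (G ⊕g H) := ⟨⟨.inr, Sum.inr_injective⟩, by simp⟩
/-- The left injection into a join. -/
def joinInl : G ↪g joinGraph G H := ⟨⟨.inl, Sum.inl_injective⟩, by simp⟩
/-- The right injection into a join. -/
def joinInr : H ↪g joinGraph G H := ⟨⟨.inr, Sum.inr_injective⟩, by simp⟩

theorem sumInl_not_adj (u : V) : ∀ w ∉ Set.range (sumInl : G ↪g (G ⊕g H)),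
    ¬ (G ⊕g H).Adj ((sumInl : G ↪g (G ⊕g H)) u) w := by
  rintro (w | w) hw
  · exact absurd ⟨w, rfl⟩ hw
  · simp [sumInl]

theorem sumInr_not_adj (u : W) : ∀ w ∉ Set.range (sumInr : H ↪g (G ⊕g H)),
    ¬ (G ⊕g H).Adj ((sumInr : H ↪g (G ⊕g H)) u) w := by
  rintro (w | w) hw
  · simp [sumInr]
  · exact absurd ⟨w, rfl⟩ hw

theorem joinInl_adj (u : V) : ∀ w ∉ Set.range (joinInl : G ↪g joinGraph G H),
    (joinGraph G H).Adj ((joinInl : G ↪g joinGraph G H) u) w := by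
  rintro (w | w) hw
  · exact absurd ⟨w, rfl⟩ hw
  · exact joinGraph_adj_inl_inr

theorem joinInr_adj (u : W) : ∀ w ∉ Set.range (joinInr : H ↪g joinGraph G H),
    (joinGraph G H).Adj ((joinInr : H ↪g joinGraph G H) u) w := by
  rintro (w | w) hw
  · exact joinGraph_adj_inr_inl
  · exact absurd ⟨w, rfl⟩ hw

theorem pathGraph_four_adj {i j : Fin 4} :
    (SimpleGraph.pathGraph 4).Adj i j ↔ i.val + 1 = j.val ∨ j.val + 1 = i.val :=
  SimpleGraph.pathGraph_adj

/-- No induced path on four vertices lies in the image of a cograph. -/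
theorem IsCograph.not_range_subset {K : SimpleGraph W} (hG : IsCograph G) (f : G ↪g K)
    (e : SimpleGraph.pathGraph 4 ↪g K) (h : ∀ i, e i ∈ Set.range f) : False := by
  choose g hg using h
  refine hG.false ⟨⟨g, fun i j hij => e.injective ?_⟩, fun {i j} => ?_⟩
  · rw [← hg, ← hg, hij]
  · rw [← e.map_adj_iff, ← hg i, ← hg j, f.map_adj_iff]
    rfl

/-- The path on four vertices is connected, so it lies within one summand. -/
theorem IsCograph.sum (hG : IsCograph G) (hH : IsCograph H) : IsCograph (G ⊕g H) := by
  refine ⟨fun e => ?_⟩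
  have a01 : (G ⊕g H).Adj (e 0) (e 1) := e.map_adj_iff.2 (by simp [pathGraph_four_adj])
  have a12 : (G ⊕g H).Adj (e 1) (e 2) := e.map_adj_iff.2 (by simp [pathGraph_four_adj])
  have a23 : (G ⊕g H).Adj (e 2) (e 3) := e.map_adj_iff.2 (by simp [pathGraph_four_adj])
  rcases h0 : e 0 with x0 | x0 <;> rcases h1 : e 1 with x1 | x1 <;>
    rcases h2 : e 2 with x2 | x2 <;> rcases h3 : e 3 with x3 | x3 <;>
    rw [h0, h1] at a01 <;> rw [h1, h2] at a12 <;> rw [h2, h3] at a23 <;> simp at a01 a12 a23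
  · refine hG.not_range_subset sumInl e fun i => ?_
    fin_cases i
    exacts [⟨x0, h0.symm⟩, ⟨x1, h1.symm⟩, ⟨x2, h2.symm⟩, ⟨x3, h3.symm⟩]
  · refine hH.not_range_subset sumInr e fun i => ?_
    fin_cases i
    exacts [⟨x0, h0.symm⟩, ⟨x1, h1.symm⟩, ⟨x2, h2.symm⟩, ⟨x3, h3.symm⟩]

/-- The complement of the path on four vertices is also connected, so the path lies within one
factor; the three non-edges used here span it. -/
theorem IsCograph.join (hG : IsCograph G) (hH : IsCograph H) : IsCograph (joinGraph G H) := by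
  refine ⟨fun e => ?_⟩
  have a02 : ¬ (joinGraph G H).Adj (e 0) (e 2) :=
    fun h => by simpa [pathGraph_four_adj] using e.map_adj_iff.1 h
  have a03 : ¬ (joinGraph G H).Adj (e 0) (e 3) :=
    fun h => by simpa [pathGraph_four_adj] using e.map_adj_iff.1 h
  have a13 : ¬ (joinGraph G H).Adj (e 1) (e 3) :=
    fun h => by simpa [pathGraph_four_adj] using e.map_adj_iff.1 h
  rcases h0 : e 0 with x0 | x0 <;> rcases h1 : e 1 with x1 | x1 <;>
    rcases h2 : e 2 with x2 | x2 <;> rcases h3 : e 3 with x3 | x3 <;>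
    rw [h0, h2] at a02 <;> rw [h0, h3] at a03 <;> rw [h1, h3] at a13 <;>
    simp at a02 a03 a13
  · refine hG.not_range_subset joinInl e fun i => ?_
    fin_cases i
    exacts [⟨x0, h0.symm⟩, ⟨x1, h1.symm⟩, ⟨x2, h2.symm⟩, ⟨x3, h3.symm⟩]
  · refine hH.not_range_subset joinInr e fun i => ?_
    fin_cases i
    exacts [⟨x0, h0.symm⟩, ⟨x1, h1.symm⟩, ⟨x2, h2.symm⟩, ⟨x3, h3.symm⟩]

end SumsAndJoins

/-! ### Preservation of maximal cliques, the compositional form of skew fibrations -/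

section MaximalCliques

variable {V W X : Type} {G : SimpleGraph V} {H : SimpleGraph W} {K : SimpleGraph X}

/-- A maximal clique: the set of all vertices that are adjacent to all other vertices in it. -/
def IsMaxClique (G : SimpleGraph V) (C : Set V) : Prop :=
  ∀ w, w ∈ C ↔ ∀ v ∈ C, v ≠ w → G.Adj w v

theorem IsMaxClique.adj {C : Set V} (h : IsMaxClique G C) {v w : V} (hv : v ∈ C) (hw : w ∈ C)
    (hvw : v ≠ w) : G.Adj v w :=
  (h v).1 hv w hw hvw.symm

theorem IsMaxClique.nonempty [Nonempty V] {C : Set V} (h : IsMaxClique G C) : C.Nonempty := by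
  by_contra hC
  rw [Set.not_nonempty_iff_eq_empty] at hC
  subst hC
  exact ((h (Classical.arbitrary V)).2 fun _ hv => absurd hv (Set.notMem_empty _))

theorem exists_isMaxClique_mem [Finite V] (v : V) : ∃ C, IsMaxClique G C ∧ v ∈ C := by
  obtain ⟨C, hvC, hC⟩ := (Set.toFinite {C : Set V | G.IsClique C}).exists_le_maximal
    (show ({v} : Set V) ∈ {C : Set V | G.IsClique C} by simp)
  refine ⟨C, fun w => ⟨fun hw u hu h => hC.1 hw hu h.symm, fun h => ?_⟩, hvC rfl⟩
  exact hC.2 (y := insert w C) (hC.1.insert fun u hu hwu => h u hu hwu.symm)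
    (Set.subset_insert _ _) (Set.mem_insert _ _)

/-- A graph homomorphism that maps maximal cliques to maximal cliques. -/
def PreservesMaxCliques (G : SimpleGraph V) (H : SimpleGraph W) (φ : V → W) : Prop :=
  IsGraphHom G H φ ∧ ∀ C, IsMaxClique G C → IsMaxClique H (φ '' C)

theorem PreservesMaxCliques.id : PreservesMaxCliques G G id :=
  ⟨fun _ _ h => h, fun C h => by simpa using h⟩

theorem PreservesMaxCliques.comp {φ : V → W} {ψ : W → X} (hψ : PreservesMaxCliques H K ψ)
    (hφ : PreservesMaxCliques G H φ) : PreservesMaxCliques G K (ψ ∘ φ) :=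
  ⟨fun v w h => hψ.1 _ _ (hφ.1 v w h), fun C h => by
    rw [Set.image_comp]
    exact hψ.2 _ (hφ.2 C h)⟩

theorem PreservesMaxCliques.isSkewFibration [Finite V] {φ : V → W}
    (h : PreservesMaxCliques G H φ) : IsSkewFibration G H φ := by
  refine ⟨h.1, fun v w hw => ?_⟩
  obtain ⟨C, hC, hv⟩ := exists_isMaxClique_mem (G := G) v
  by_contra! hn
  -- Under the assumption to be refuted, `w` is adjacent to the image of every vertex of `C`, so
  -- maximality of the image clique captures it.
  have hwC : w ∈ φ '' C := by
    rw [h.2 C hC w]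
    rintro _ ⟨u, hu, rfl⟩ _
    by_cases e : u = v
    · exact e ▸ hw
    · exact (hn u (hC.adj hu hv e)).symm
  obtain ⟨u, hu, rfl⟩ := hwC
  by_cases e : u = v
  · subst e; exact hw.ne rfl
  · exact (hn u (hC.adj hu hv e)).ne rfl

theorem preservesMaxCliques_of_equiv (e : V ≃ W) (he : ∀ v w, H.Adj (e v) (e w) ↔ G.Adj v w) :
    PreservesMaxCliques G H e := by
  refine ⟨fun v w => (he v w).2, fun C hC w => ?_⟩
  obtain ⟨w, rfl⟩ := e.surjective w
  rw [e.injective.mem_set_image, hC w, Set.forall_mem_image]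
  simp only [he, ne_eq, e.injective.eq_iff]

/-- Nonemptiness matters: it supplies a vertex of the clique that no vertex of the other summand can
see. The empty set is a maximal clique of the empty graph and would break this. -/
theorem isMaxClique_sum_inl [Nonempty V] {C : Set V} (h : IsMaxClique G C) :
    IsMaxClique (G ⊕g H) (Sum.inl '' C) := by
  obtain ⟨v, hv⟩ := h.nonempty
  rintro (w | w)
  · simp [h w]
  · simp only [Set.mem_image, reduceCtorEq, and_false, exists_false, false_iff]
    intro hn
    simpa using hn _ ⟨v, hv, rfl⟩ (by simp)

theorem isMaxClique_sum_inr [Nonempty W] {C : Set W} (h : IsMaxClique H C) :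
    IsMaxClique (G ⊕g H) (Sum.inr '' C) := by
  obtain ⟨v, hv⟩ := h.nonempty
  rintro (w | w)
  · simp only [Set.mem_image, reduceCtorEq, and_false, exists_false, false_iff]
    intro hn
    simpa using hn _ ⟨v, hv, rfl⟩ (by simp)
  · simp [h w]

theorem IsMaxClique.sum_cases [Nonempty V] {C : Set (V ⊕ W)}
    (h : IsMaxClique (G ⊕g H) C) :
    (∃ D, IsMaxClique G D ∧ C = Sum.inl '' D) ∨ (∃ D, IsMaxClique H D ∧ C = Sum.inr '' D) := by
  have : Nonempty (V ⊕ W) := ⟨.inl (Classical.arbitrary V)⟩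
  obtain ⟨v | v, hv⟩ := h.nonempty
  · left
    have hr : ∀ w, Sum.inr w ∉ C := fun w hw => by simpa using h.adj hv hw (by simp)
    refine ⟨Sum.inl ⁻¹' C, fun w => ?_, ?_⟩
    · simp [h (.inl w), Sum.forall, hr]
    · ext (w | w) <;> simp [hr]
  · right
    have hr : ∀ w, Sum.inl w ∉ C := fun w hw => by simpa using h.adj hv hw (by simp)
    refine ⟨Sum.inr ⁻¹' C, fun w => ?_, ?_⟩
    · simp [h (.inr w), Sum.forall, hr]
    · ext (w | w) <;> simp [hr]

theorem isMaxClique_join {C : Set V} {D : Set W} (hC : IsMaxClique G C) (hD : IsMaxClique H D) :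
    IsMaxClique (joinGraph G H) (Sum.inl '' C ∪ Sum.inr '' D) := by
  rintro (w | w)
  · simp [hC w, or_imp, forall_and]
  · simp [hD w, or_imp, forall_and]

theorem IsMaxClique.join_cases {C : Set (V ⊕ W)} (h : IsMaxClique (joinGraph G H) C) :
    ∃ D E, IsMaxClique G D ∧ IsMaxClique H E ∧ C = Sum.inl '' D ∪ Sum.inr '' E := by
  refine ⟨Sum.inl ⁻¹' C, Sum.inr ⁻¹' C, fun w => ?_, fun w => ?_, ?_⟩
  · simp [h (.inl w), Sum.forall]
  · simp [h (.inr w), Sum.forall]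
  · ext (w | w) <;> simp

variable {V' W' : Type} {G' : SimpleGraph V'} {H' : SimpleGraph W'}

theorem PreservesMaxCliques.sum [Nonempty V] [Nonempty W] [Nonempty V'] [Nonempty W']
    {φ : V → V'} {ψ : W → W'} (hφ : PreservesMaxCliques G G' φ)
    (hψ : PreservesMaxCliques H H' ψ) :
    PreservesMaxCliques (G ⊕g H) (G' ⊕g H') (Sum.map φ ψ) := by
  constructor
  · rintro (v | v) (w | w) h <;> simp at h ⊢
    · exact hφ.1 _ _ h
    · exact hψ.1 _ _ h
  · intro C hC
    rcases hC.sum_cases with ⟨D, hD, rfl⟩ | ⟨D, hD, rfl⟩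
    · rw [Set.image_image]
      simpa [Set.image_image] using isMaxClique_sum_inl (H := H') (hφ.2 D hD)
    · rw [Set.image_image]
      simpa [Set.image_image] using isMaxClique_sum_inr (G := G') (hψ.2 D hD)

theorem PreservesMaxCliques.join {φ : V → V'} {ψ : W → W'} (hφ : PreservesMaxCliques G G' φ)
    (hψ : PreservesMaxCliques H H' ψ) :
    PreservesMaxCliques (joinGraph G H) (joinGraph G' H') (Sum.map φ ψ) := by
  constructor
  · rintro (v | v) (w | w) h <;> simp at h ⊢
    · exact hφ.1 _ _ h
    · exact hψ.1 _ _ h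
  · intro C hC
    obtain ⟨D, E, hD, hE, rfl⟩ := hC.join_cases
    have := isMaxClique_join (hφ.2 D hD) (hψ.2 E hE)
    simpa [Set.image_image, Set.image_union] using this

/-- Medial adds edges, yet a maximal clique of the premise lies in one of the two joins, and its two
halves remain maximal in the larger factors. -/
theorem preservesMaxCliques_medial {X' : Type} {K' : SimpleGraph X'}
    [Nonempty V] [Nonempty W] [Nonempty X] [Nonempty X'] :
    PreservesMaxCliques (joinGraph G H ⊕g joinGraph K K') (joinGraph (G ⊕g K) (H ⊕g K'))
      (Equiv.sumSumSumComm V W X X') := by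
  constructor
  · rintro ((v | v) | (v | v)) ((w | w) | (w | w)) h <;> simp at h ⊢ <;> exact h
  · intro C hC
    rcases hC.sum_cases with ⟨D', h, rfl⟩ | ⟨D', h, rfl⟩ <;>
      obtain ⟨D, E, hD, hE, rfl⟩ := h.join_cases
    · have := isMaxClique_join (isMaxClique_sum_inl (H := K) hD)
        (isMaxClique_sum_inl (H := K') hE)
      simpa [Set.image_image, Set.image_union] using this
    · have := isMaxClique_join (isMaxClique_sum_inr (G := G) hD)
        (isMaxClique_sum_inr (G := H) hE)
      simpa [Set.image_image, Set.image_union] using this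

/-- A maximal clique of the premise uses only one of the two merged vertices, since it lies in one
summand. -/
theorem preservesMaxCliques_mergeMap_join {I : SimpleGraph Unit} [Nonempty V] [Nonempty W]
    [Nonempty V'] [Nonempty W'] {φ : V → V'} {ψ : W → W'} (hφ : PreservesMaxCliques G G' φ)
    (hψ : PreservesMaxCliques H H' ψ) :
    PreservesMaxCliques (joinGraph I G ⊕g joinGraph I H) (joinGraph I (G' ⊕g H'))
      (mergeMap φ ψ) := by
  constructor
  · rintro ((v | v) | (v | v)) ((w | w) | (w | w)) h <;> simp [mergeMap] at h ⊢
    · exact hφ.1 _ _ h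
    · exact hψ.1 _ _ h
  · intro C hC
    rcases hC.sum_cases with ⟨D', h, rfl⟩ | ⟨D', h, rfl⟩ <;>
      obtain ⟨D, E, hD, hE, rfl⟩ := h.join_cases
    · have := isMaxClique_join hD (isMaxClique_sum_inl (H := H') (hφ.2 E hE))
      simpa [Set.image_image, Set.image_union, mergeMap] using this
    · have := isMaxClique_join hD (isMaxClique_sum_inr (G := G') (hψ.2 E hE))
      simpa [Set.image_image, Set.image_union, mergeMap] using this

theorem preservesMaxCliques_mergeMap_sum {I : SimpleGraph Unit} [Nonempty V] [Nonempty W]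
    [Nonempty V'] [Nonempty W'] {φ : V → V'} {ψ : W → W'} (hφ : PreservesMaxCliques G G' φ)
    (hψ : PreservesMaxCliques H H' ψ) :
    PreservesMaxCliques ((I ⊕g G) ⊕g (I ⊕g H)) (I ⊕g (G' ⊕g H')) (mergeMap φ ψ) := by
  constructor
  · rintro ((v | v) | (v | v)) ((w | w) | (w | w)) h <;> simp [mergeMap] at h ⊢
    · exact hφ.1 _ _ h
    · exact hψ.1 _ _ h
  · intro C hC
    rcases hC.sum_cases with ⟨D', h, rfl⟩ | ⟨D', h, rfl⟩ <;>
      rcases h.sum_cases with ⟨D, hD, rfl⟩ | ⟨D, hD, rfl⟩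
    · have := isMaxClique_sum_inl (H := G' ⊕g H') hD
      simpa [Set.image_image, mergeMap] using this
    · have := isMaxClique_sum_inr (G := I) (isMaxClique_sum_inl (H := H') (hφ.2 D hD))
      simpa [Set.image_image, mergeMap] using this
    · have := isMaxClique_sum_inl (H := G' ⊕g H') hD
      simpa [Set.image_image, mergeMap] using this
    · have := isMaxClique_sum_inr (G := I) (isMaxClique_sum_inr (G := G') (hψ.2 D hD))
      simpa [Set.image_image, mergeMap] using this

theorem preservesMaxCliques_inl [Nonempty V] :
    PreservesMaxCliques G (G ⊕g H) Sum.inl :=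
  ⟨fun _ _ h => by simpa using h, fun _ hC => isMaxClique_sum_inl hC⟩

theorem preservesMaxCliques_inr [Nonempty W] :
    PreservesMaxCliques H (G ⊕g H) Sum.inr :=
  ⟨fun _ _ h => by simpa using h, fun _ hC => isMaxClique_sum_inr hC⟩

theorem PreservesMaxCliques.sum_elim [Nonempty V] {φ : V → X} {ψ : W → X}
    (hφ : PreservesMaxCliques G K φ) (hψ : PreservesMaxCliques H K ψ) :
    PreservesMaxCliques (G ⊕g H) K (Sum.elim φ ψ) := by
  constructor
  · rintro (v | v) (w | w) h <;> simp at h ⊢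
    · exact hφ.1 _ _ h
    · exact hψ.1 _ _ h
  · intro C hC
    rcases hC.sum_cases with ⟨D, hD, rfl⟩ | ⟨D, hD, rfl⟩
    · simpa [Set.image_image] using hφ.2 D hD
    · simpa [Set.image_image] using hψ.2 D hD

end MaximalCliques

/-! ### Composition of fibrations of directed graphs -/

section DigraphFibrations

variable {V W X : Type} {G : Digraph V} {H : Digraph W} {K : Digraph X}

theorem IsDigraphFibration.id : IsDigraphFibration G G id :=
  ⟨fun _ _ h => h, fun _ w h => ⟨w, ⟨h, rfl⟩, fun _ h' => h'.2⟩⟩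

theorem IsDigraphFibration.comp {φ : V → W} {ψ : W → X} (hψ : IsDigraphFibration H K ψ)
    (hφ : IsDigraphFibration G H φ) : IsDigraphFibration G K (ψ ∘ φ) := by
  refine ⟨fun v w h => hψ.1 _ _ (hφ.1 v w h), fun v w h => ?_⟩
  obtain ⟨w', ⟨h1, rfl⟩, h2⟩ := hψ.2 _ _ h
  obtain ⟨w, ⟨h3, rfl⟩, h4⟩ := hφ.2 _ _ h1
  exact ⟨w, ⟨h3, rfl⟩, fun y hy => h4 y ⟨hy.1, h2 _ ⟨hφ.1 _ _ hy.1, hy.2⟩⟩⟩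

end DigraphFibrations

end FOGraph
namespace FOGraph

/-! ### Variable renamings on atoms and labels -/

section Renaming

variable {L : FirstOrder.Language.{u, v}} {α : Type w}

theorem Atom.rename_id (a : Atom L α) : a.rename id = a := by
  cases a <;> simp [rename]

theorem Atom.rename_rename (ρ σ : α → α) (a : Atom L α) :
    (a.rename ρ).rename σ = a.rename (σ ∘ ρ) := by
  cases a <;> simp [rename]

theorem Label.rename_id (l : Label L α) : l.rename id = l := by
  cases l <;> simp [rename, Atom.rename_id]

theorem Label.rename_rename (ρ σ : α → α) (l : Label L α) :
    (l.rename ρ).rename σ = l.rename (σ ∘ ρ) := by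
  cases l <;> simp [rename, Atom.rename_rename]

variable [DecidableEq α]

theorem relabel_congr {ρ σ : α → α} {t : L.Term α} (h : ∀ x ∈ t.varFinset, ρ x = σ x) :
    t.relabel ρ = t.relabel σ := by
  induction t with
  | var x => simpa using h x (by simp)
  | func f ts ih =>
    simp only [FirstOrder.Language.Term.relabel, FirstOrder.Language.Term.func.injEq, heq_eq_eq,
      true_and]
    funext i
    exact ih i fun x hx => h x (by simpa using ⟨i, hx⟩)

theorem varFinset_relabel (ρ : α → α) (t : L.Term α) :
    (t.relabel ρ).varFinset = t.varFinset.image ρ := by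
  induction t with
  | var x => simp
  | func f ts ih => ext x; simp [ih]; grind

theorem Atom.rename_congr {ρ σ : α → α} {a : Atom L α} (h : ∀ x ∈ a.vars, ρ x = σ x) :
    a.rename ρ = a.rename σ := by
  cases a with
  | tt => rfl
  | ff => rfl
  | pred p ts =>
    simp only [rename, pred.injEq, heq_eq_eq, true_and]
    funext i
    exact relabel_congr fun x hx => h x (by simpa [vars] using ⟨i, hx⟩)
  | dualPred p ts =>
    simp only [rename, dualPred.injEq, heq_eq_eq, true_and]
    funext i
    exact relabel_congr fun x hx => h x (by simpa [vars] using ⟨i, hx⟩)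

theorem Atom.vars_rename (ρ : α → α) (a : Atom L α) : (a.rename ρ).vars = a.vars.image ρ := by
  cases a <;> ext x <;> simp [rename, vars, varFinset_relabel] <;> grind

theorem Label.rename_congr {ρ σ : α → α} {l : Label L α} (h : ∀ x ∈ l.vars, ρ x = σ x) :
    l.rename ρ = l.rename σ := by
  cases l with
  | lit a => exact congrArg _ (Atom.rename_congr h)
  | binder x => exact congrArg _ (h x (by simp [vars]))

theorem Label.rename_eq_self {ρ : α → α} {l : Label L α} (h : ∀ x ∈ l.vars, ρ x = x) :
    l.rename ρ = l :=
  (rename_congr h).trans l.rename_id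

end Renaming

/-! ### Scopes, binders and existentials in the graph of a formula -/

section GraphsOfFormulas

variable {L : FirstOrder.Language.{u, v}} {α : Type w}

instance (A : Form L α) : Finite (Vert A) := (graphOf A).finite

theorem exists_isLiteral (A : Form L α) : ∃ l, (graphOf A).IsLiteral l := by
  induction A with
  | atom a => exact ⟨(), a, rfl⟩
  | and A B ihA _ => obtain ⟨l, a, h⟩ := ihA; exact ⟨.inl l, a, h⟩
  | or A B ihA _ => obtain ⟨l, a, h⟩ := ihA; exact ⟨.inl l, a, h⟩
  | ex x A ih => obtain ⟨l, a, h⟩ := ih; exact ⟨.inr l, a, h⟩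
  | all x A ih => obtain ⟨l, a, h⟩ := ih; exact ⟨.inr l, a, h⟩

instance (A : Form L α) : Nonempty (Vert A) := (exists_isLiteral A).nonempty

/-- The graph underlying `G(A)`. -/
abbrev gr (A : Form L α) : SimpleGraph (Vert A) := (graphOf A).graph

/-- The label of a vertex of `G(A)`. -/
abbrev lab (A : Form L α) : Vert A → Label L α := (graphOf A).label

theorem isCograph_of_subsingleton {V : Type} [Subsingleton V] (G : SimpleGraph V) :
    IsCograph G :=
  ⟨fun e => absurd (e.injective (Subsingleton.elim (e 0) (e 1))) (by decide)⟩

theorem isCograph_graphOf (A : Form L α) : IsCograph (gr A) := by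
  induction A with
  | atom a => exact isCograph_of_subsingleton (V := Unit) _
  | and A B ihA ihB => exact ihA.join ihB
  | or A B ihA ihB => exact ihA.sum ihB
  | ex x A ih => exact (isCograph_of_subsingleton (V := Unit) ⊥).join ih
  | all x A ih => exact (isCograph_of_subsingleton (V := Unit) ⊥).sum ih

/-- The vertices that come from an existential quantifier. -/
def IsExVertex : (A : Form L α) → Vert A → Prop
  | .atom _ => fun _ => False
  | .and A B => Sum.elim (IsExVertex A) (IsExVertex B)
  | .or A B => Sum.elim (IsExVertex A) (IsExVertex B)
  | .ex _ A => Sum.elim (fun _ => True) (IsExVertex A)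
  | .all _ A => Sum.elim (fun _ => False) (IsExVertex A)

/-- The outermost quantifier sees the body uniformly, so the body is a module and the scope is
everything. -/
theorem mem_scope_quantifier_join {V : Type} {G : SimpleGraph V} (c : Unit ⊕ V) :
    c ∈ scope (joinGraph (⊥ : SimpleGraph Unit) G) (.inl ()) := by
  refine mem_scope_of_isGraphModule_compl ?_ c
  have : ({Sum.inl ()}ᶜ : Set (Unit ⊕ V)) = Set.range (joinInr (G := (⊥ : SimpleGraph Unit))
      (H := G)) := by
    ext (v | v) <;> simp [joinInr]
  rw [this]
  exact isGraphModule_range_of_adj joinInr_adj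

theorem mem_scope_quantifier_sum {V : Type} {G : SimpleGraph V} (c : Unit ⊕ V) :
    c ∈ scope ((⊥ : SimpleGraph Unit) ⊕g G) (.inl ()) := by
  refine mem_scope_of_isGraphModule_compl ?_ c
  have : ({Sum.inl ()}ᶜ : Set (Unit ⊕ V)) = Set.range (sumInr (G := (⊥ : SimpleGraph Unit))
      (H := G)) := by
    ext (v | v) <;> simp [sumInr]
  rw [this]
  exact isGraphModule_range_of_not_adj sumInr_not_adj

section Scopes

variable {V W : Type} {G : SimpleGraph V} {H : SimpleGraph W}

theorem inl_mem_scope_sum {b c : V} (h : c ∈ scope G b) :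
    Sum.inl c ∈ scope (G ⊕g H) (.inl b) :=
  map_mem_scope sumInl (isGraphModule_range_of_not_adj sumInl_not_adj) h

theorem inr_mem_scope_sum {b c : W} (h : c ∈ scope H b) :
    Sum.inr c ∈ scope (G ⊕g H) (.inr b) :=
  map_mem_scope sumInr (isGraphModule_range_of_not_adj sumInr_not_adj) h

theorem inl_mem_scope_join {b c : V} (h : c ∈ scope G b) :
    Sum.inl c ∈ scope (joinGraph G H) (.inl b) :=
  map_mem_scope joinInl (isGraphModule_range_of_adj joinInl_adj) h

theorem inr_mem_scope_join {b c : W} (h : c ∈ scope H b) :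
    Sum.inr c ∈ scope (joinGraph G H) (.inr b) :=
  map_mem_scope joinInr (isGraphModule_range_of_adj joinInr_adj) h

end Scopes

theorem exists_literal_mem_scope (A : Form L α) (b : Vert A) (hb : (graphOf A).IsBinder b) :
    ∃ l ∈ scope (gr A) b, (graphOf A).IsLiteral l := by
  induction A with
  | atom a => obtain ⟨x, hx⟩ := hb; cases hx
  | and A B ihA ihB =>
    obtain b | b := b
    · obtain ⟨l, h, h'⟩ := ihA b hb
      exact ⟨.inl l, inl_mem_scope_join h, h'⟩
    · obtain ⟨l, h, h'⟩ := ihB b hb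
      exact ⟨.inr l, inr_mem_scope_join h, h'⟩
  | or A B ihA ihB =>
    obtain b | b := b
    · obtain ⟨l, h, h'⟩ := ihA b hb
      exact ⟨.inl l, inl_mem_scope_sum h, h'⟩
    · obtain ⟨l, h, h'⟩ := ihB b hb
      exact ⟨.inr l, inr_mem_scope_sum h, h'⟩
  | ex x A ih =>
    obtain b | b := b
    · obtain ⟨l, h⟩ := exists_isLiteral A
      exact ⟨.inr l, mem_scope_quantifier_join _, h⟩
    · obtain ⟨l, h, h'⟩ := ih b hb
      exact ⟨.inr l, inr_mem_scope_join h, h'⟩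
  | all x A ih =>
    obtain b | b := b
    · obtain ⟨l, h⟩ := exists_isLiteral A
      exact ⟨.inr l, mem_scope_quantifier_sum _, h⟩
    · obtain ⟨l, h, h'⟩ := ih b hb
      exact ⟨.inr l, inr_mem_scope_sum h, h'⟩

/-- At its own quantifier the vertex dominates the whole graph; each enclosing connective or
quantifier then acts as a union or a join. -/
theorem IsExVertex.dominatesStrongModule {A : Form L α} {b : Vert A} (hb : IsExVertex A b) :
    DominatesStrongModule (gr A) b := by
  induction A with
  | atom a => exact hb.elim
  | and A B ihA ihB =>
    obtain b | b := b
    · exact (ihA hb).map_of_adj joinInl joinInl_adj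
    · exact (ihB hb).map_of_adj joinInr joinInr_adj
  | or A B ihA ihB =>
    obtain b | b := b
    · exact (ihA hb).map_of_not_adj sumInl sumInl_not_adj
    · exact (ihB hb).map_of_not_adj sumInr sumInr_not_adj
  | ex x A ih =>
    obtain b | b := b
    · obtain ⟨l, _⟩ := exists_isLiteral A
      refine ⟨Set.univ, isStrongModule_univ, ⟨.inl (), trivial, .inr l, trivial, Sum.inl_ne_inr⟩,
        trivial, ?_⟩
      rintro (c | c) _ hc
      · exact absurd rfl hc
      · exact joinGraph_adj_inl_inr
    · exact (ih hb).map_of_adj joinInr joinInr_adj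
  | all x A ih =>
    obtain b | b := b
    · exact hb.elim
    · exact (ih hb).map_of_not_adj sumInr sumInr_not_adj

theorem IsExVertex.isBinder {A : Form L α} {b : Vert A} (hb : IsExVertex A b) :
    (graphOf A).IsBinder b := by
  induction A with
  | atom a => exact hb.elim
  | and A B ihA ihB => exact b.casesOn (fun _ h => ihA h) (fun _ h => ihB h) hb
  | or A B ihA ihB => exact b.casesOn (fun _ h => ihA h) (fun _ h => ihB h) hb
  | ex x A ih => exact b.casesOn (fun _ _ => ⟨x, rfl⟩) (fun _ h => ih h) hb
  | all x A ih => exact b.casesOn (fun _ h => h.elim) (fun _ h => ih h) hb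

/-- A universal quantifier is not adjacent to any literal of its body, which is in its scope;
embedding into a larger formula enlarges scopes and creates no edge between old vertices. -/
theorem exists_mem_scope_not_adj {A : Form L α} {b : Vert A} (hb : (graphOf A).IsBinder b)
    (hA : ¬ IsExVertex A b) : ∃ c ∈ scope (gr A) b, c ≠ b ∧ ¬ (gr A).Adj b c := by
  induction A with
  | atom a => obtain ⟨x, hx⟩ := hb; cases hx
  | and A B ihA ihB =>
    obtain b | b := b
    · obtain ⟨c, h, h', h''⟩ := ihA hb hA
      exact ⟨.inl c, inl_mem_scope_join h, Sum.inl_injective.ne h',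
        fun h => h'' (joinGraph_adj_inl_inl.1 h)⟩
    · obtain ⟨c, h, h', h''⟩ := ihB hb hA
      exact ⟨.inr c, inr_mem_scope_join h, Sum.inr_injective.ne h',
        fun h => h'' (joinGraph_adj_inr_inr.1 h)⟩
  | or A B ihA ihB =>
    obtain b | b := b
    · obtain ⟨c, h, h', h''⟩ := ihA hb hA
      exact ⟨.inl c, inl_mem_scope_sum h, Sum.inl_injective.ne h', h''⟩
    · obtain ⟨c, h, h', h''⟩ := ihB hb hA
      exact ⟨.inr c, inr_mem_scope_sum h, Sum.inr_injective.ne h', h''⟩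
  | ex x A ih =>
    obtain b | b := b
    · exact absurd trivial hA
    · obtain ⟨c, h, h', h''⟩ := ih hb hA
      exact ⟨.inr c, inr_mem_scope_join h, Sum.inr_injective.ne h',
        fun h => h'' (joinGraph_adj_inr_inr.1 h)⟩
  | all x A ih =>
    obtain b | b := b
    · obtain ⟨l, _⟩ := exists_isLiteral A
      exact ⟨.inr l, mem_scope_quantifier_sum _, Sum.inr_ne_inl,
        show ¬ ((⊥ : SimpleGraph Unit) ⊕g gr A).Adj (.inl b) (.inr l) by simp⟩
    · obtain ⟨c, h, h', h''⟩ := ih hb hA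
      exact ⟨.inr c, inr_mem_scope_sum h, Sum.inr_injective.ne h', h''⟩

/-- The existential binders of `G(A)` are those that come from existential quantifiers. -/
theorem isExistential_graphOf_iff {A : Form L α} {b : Vert A} :
    (graphOf A).IsExistential b ↔ IsExVertex A b := by
  refine ⟨fun h => ?_, fun h =>
    ⟨h.isBinder, fun c hc hcb => h.dominatesStrongModule.adj_of_mem_scope hc hcb⟩⟩
  by_contra hn
  obtain ⟨c, h1, h2, h3⟩ := exists_mem_scope_not_adj h.1 hn
  exact h3 (h.2 c h1 h2)

theorem mem_boundVars_iff {A : Form L α} {x : α} :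
    x ∈ A.boundVars ↔ ∃ b, (graphOf A).IsBinderOf x b := by
  induction A with
  | atom a => exact ⟨fun h => by simp [Form.boundVars] at h, fun ⟨_, h⟩ => by cases h⟩
  | and A B ihA ihB =>
    rw [Form.boundVars, List.mem_append, ihA, ihB]
    exact (Sum.exists (p := fun b => (graphOf (A.and B)).IsBinderOf x b)).symm
  | or A B ihA ihB =>
    rw [Form.boundVars, List.mem_append, ihA, ihB]
    exact (Sum.exists (p := fun b => (graphOf (A.or B)).IsBinderOf x b)).symm
  | ex y A ih =>
    rw [Form.boundVars, List.mem_cons, ih]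
    refine Iff.trans ?_ Sum.exists.symm
    exact or_congr ⟨fun h => ⟨(), by rw [h]; rfl⟩, fun ⟨_, h⟩ => by cases h; rfl⟩ Iff.rfl
  | all y A ih =>
    rw [Form.boundVars, List.mem_cons, ih]
    refine Iff.trans ?_ Sum.exists.symm
    exact or_congr ⟨fun h => ⟨(), by rw [h]; rfl⟩, fun ⟨_, h⟩ => by cases h; rfl⟩ Iff.rfl

theorem binder_unique {A : Form L α} (hA : A.boundVars.Nodup) {x : α} {b c : Vert A}
    (hb : (graphOf A).IsBinderOf x b) (hc : (graphOf A).IsBinderOf x c) : b = c := by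
  induction A with
  | atom a => rfl
  | and A B ihA ihB =>
    obtain ⟨h1, h2, h3⟩ := List.nodup_append'.1 hA
    obtain b | b := b <;> obtain c | c := c
    · exact congrArg _ (ihA h1 hb hc)
    · exact (h3 (mem_boundVars_iff.2 ⟨b, hb⟩) (mem_boundVars_iff.2 ⟨c, hc⟩)).elim
    · exact (h3 (mem_boundVars_iff.2 ⟨c, hc⟩) (mem_boundVars_iff.2 ⟨b, hb⟩)).elim
    · exact congrArg _ (ihB h2 hb hc)
  | or A B ihA ihB =>
    obtain ⟨h1, h2, h3⟩ := List.nodup_append'.1 hA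
    obtain b | b := b <;> obtain c | c := c
    · exact congrArg _ (ihA h1 hb hc)
    · exact (h3 (mem_boundVars_iff.2 ⟨b, hb⟩) (mem_boundVars_iff.2 ⟨c, hc⟩)).elim
    · exact (h3 (mem_boundVars_iff.2 ⟨c, hc⟩) (mem_boundVars_iff.2 ⟨b, hb⟩)).elim
    · exact congrArg _ (ihB h2 hb hc)
  | ex y A ih =>
    obtain ⟨h1, h2⟩ := List.nodup_cons.1 hA
    obtain b | b := b <;> obtain c | c := c
    · rfl
    · cases hb; exact (h1 (mem_boundVars_iff.2 ⟨c, hc⟩)).elim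
    · cases hc; exact (h1 (mem_boundVars_iff.2 ⟨b, hb⟩)).elim
    · exact congrArg _ (ih h2 hb hc)
  | all y A ih =>
    obtain ⟨h1, h2⟩ := List.nodup_cons.1 hA
    obtain b | b := b <;> obtain c | c := c
    · rfl
    · cases hb; exact (h1 (mem_boundVars_iff.2 ⟨c, hc⟩)).elim
    · cases hc; exact (h1 (mem_boundVars_iff.2 ⟨b, hb⟩)).elim
    · exact congrArg _ (ih h2 hb hc)

end GraphsOfFormulas

/-! ### Rectified formulas: legality and the binding graph without scopes -/

section RectifiedFormulas

variable {L : FirstOrder.Language.{u, v}} {α : Type w} [DecidableEq α]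

theorem mem_vars_iff {A : Form L α} {x : α} : x ∈ A.vars ↔ x ∈ A.freeVars ∨ x ∈ A.boundVars := by
  induction A with
  | atom a => simp [Form.vars, Form.freeVars, Form.boundVars]
  | and A B ihA ihB => simp [Form.vars, Form.freeVars, Form.boundVars, ihA, ihB]; tauto
  | or A B ihA ihB => simp [Form.vars, Form.freeVars, Form.boundVars, ihA, ihB]; tauto
  | ex y A ih => simp [Form.vars, Form.freeVars, Form.boundVars, ih]; tauto
  | all y A ih => simp [Form.vars, Form.freeVars, Form.boundVars, ih]; tauto

theorem mem_vars_of_label {A : Form L α} {x : α} {v : Vert A} (h : x ∈ (lab A v).vars) :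
    x ∈ A.vars := by
  induction A with
  | atom a => exact h
  | and A B ihA ihB =>
    exact Finset.mem_union.2 (v.casesOn (fun _ h => .inl (ihA h)) (fun _ h => .inr (ihB h)) h)
  | or A B ihA ihB =>
    exact Finset.mem_union.2 (v.casesOn (fun _ h => .inl (ihA h)) (fun _ h => .inr (ihB h)) h)
  | ex y A ih =>
    exact Finset.mem_insert.2
      (v.casesOn (fun _ h => .inl (Finset.mem_singleton.1 h)) (fun _ h => .inr (ih h)) h)
  | all y A ih =>
    exact Finset.mem_insert.2
      (v.casesOn (fun _ h => .inl (Finset.mem_singleton.1 h)) (fun _ h => .inr (ih h)) h)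

namespace Form.Rectified

variable {A B : Form L α} {x : α}

theorem of_and (h : (Form.and A B).Rectified) : A.Rectified ∧ B.Rectified ∧
    (∀ x ∈ A.boundVars, x ∉ B.vars) ∧ ∀ x ∈ B.boundVars, x ∉ A.vars := by
  obtain ⟨h1, h2⟩ := h
  obtain ⟨h3, h4, h5⟩ := List.nodup_append'.1 h1
  simp only [boundVars, List.mem_append, freeVars, Finset.mem_union] at h2
  refine ⟨⟨h3, fun x hx hx' => h2 x (.inl hx) (.inl hx')⟩,
    ⟨h4, fun x hx hx' => h2 x (.inr hx) (.inr hx')⟩, fun x hx hx' => ?_, fun x hx hx' => ?_⟩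
  · rcases mem_vars_iff.1 hx' with h | h
    exacts [h2 x (.inl hx) (.inr h), h5 hx h]
  · rcases mem_vars_iff.1 hx' with h | h
    exacts [h2 x (.inr hx) (.inl h), h5 h hx]

theorem of_or (h : (Form.or A B).Rectified) : A.Rectified ∧ B.Rectified ∧
    (∀ x ∈ A.boundVars, x ∉ B.vars) ∧ ∀ x ∈ B.boundVars, x ∉ A.vars :=
  -- Bound and free variables do not distinguish the connectives, so the two cases agree by
  -- definition.
  of_and (A := A) (B := B) h

theorem of_ex (h : (Form.ex x A).Rectified) : A.Rectified ∧ x ∉ A.boundVars := by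
  obtain ⟨h1, h2⟩ := h
  obtain ⟨h3, h4⟩ := List.nodup_cons.1 h1
  refine ⟨⟨h4, fun y hy hy' => h2 y (List.mem_cons_of_mem _ hy) (Finset.mem_erase.2 ⟨?_, hy'⟩)⟩, h3⟩
  rintro rfl
  exact h3 hy

theorem of_all (h : (Form.all x A).Rectified) : A.Rectified ∧ x ∉ A.boundVars :=
  of_ex (x := x) (A := A) h

end Form.Rectified

/-- In a rectified formula, the scope of the `x`-binder contains all literals in which `x` occurs. -/
theorem mem_scope_of_mem_vars {A : Form L α} (hA : A.Rectified) {b l : Vert A} {x : α}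
    (hb : (graphOf A).IsBinderOf x b) (hl : x ∈ (lab A l).vars) : l ∈ scope (gr A) b := by
  induction A with
  | atom a => cases hb
  | and A B ihA ihB =>
    obtain ⟨h1, h2, h3, h4⟩ := hA.of_and
    obtain b | b := b <;> obtain l | l := l
    · exact inl_mem_scope_join (ihA h1 hb hl)
    · exact (h3 x (mem_boundVars_iff.2 ⟨b, hb⟩) (mem_vars_of_label hl)).elim
    · exact (h4 x (mem_boundVars_iff.2 ⟨b, hb⟩) (mem_vars_of_label hl)).elim
    · exact inr_mem_scope_join (ihB h2 hb hl)
  | or A B ihA ihB =>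
    obtain ⟨h1, h2, h3, h4⟩ := hA.of_or
    obtain b | b := b <;> obtain l | l := l
    · exact inl_mem_scope_sum (ihA h1 hb hl)
    · exact (h3 x (mem_boundVars_iff.2 ⟨b, hb⟩) (mem_vars_of_label hl)).elim
    · exact (h4 x (mem_boundVars_iff.2 ⟨b, hb⟩) (mem_vars_of_label hl)).elim
    · exact inr_mem_scope_sum (ihB h2 hb hl)
  | ex y A ih =>
    obtain ⟨h1, h2⟩ := hA.of_ex
    obtain b | b := b
    · exact mem_scope_quantifier_join _
    obtain l | l := l
    · rw [Finset.mem_singleton.1 hl] at hb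
      exact (h2 (mem_boundVars_iff.2 ⟨b, hb⟩)).elim
    · exact inr_mem_scope_join (ih h1 hb hl)
  | all y A ih =>
    obtain ⟨h1, h2⟩ := hA.of_all
    obtain b | b := b
    · exact mem_scope_quantifier_sum _
    obtain l | l := l
    · rw [Finset.mem_singleton.1 hl] at hb
      exact (h2 (mem_boundVars_iff.2 ⟨b, hb⟩)).elim
    · exact inr_mem_scope_sum (ih h1 hb hl)

/-- Each variable has at most one binder in the entire graph, so uniqueness within a scope is
automatic. -/
theorem Form.Rectified.isFograph {A : Form L α} (hA : A.Rectified) : (graphOf A).IsFograph :=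
  ⟨isCograph_graphOf A, exists_isLiteral A, fun x b hb =>
    ⟨fun _ _ hc => binder_unique hA.1 hc hb, exists_literal_mem_scope A b ⟨x, hb⟩⟩⟩

theorem Form.Rectified.bindingGraph_adj_iff {A : Form L α} (hA : A.Rectified) {b l : Vert A} :
    (graphOf A).bindingGraph.Adj b l ↔
      ∃ x a, (graphOf A).IsBinderOf x b ∧ lab A l = .lit a ∧ x ∈ a.vars := by
  constructor
  · rintro ⟨x, a, h1, h2, h3, _⟩
    exact ⟨x, a, h1, h2, h3⟩
  · rintro ⟨x, a, h1, h2, h3⟩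
    refine ⟨x, a, h1, h2, h3, mem_scope_of_mem_vars hA h1 ?_⟩
    rw [h2]
    exact h3

/-- A label-preserving map, up to a renaming of variables that is harmless for the source and keeps
free variables free, is a fibration of binding graphs. -/
theorem isDigraphFibration_of_rename {A B : Form L α} (hA : A.Rectified) (hB : B.Rectified)
    {φ : Vert A → Vert B} {ρ : α → α} (hφ : ∀ v, lab B (φ v) = (lab A v).rename ρ)
    (hinj : ∀ v a, lab A v = .lit a → Set.InjOn ρ a.vars)
    (hfree : ∀ x ∈ A.freeVars, ρ x ∈ B.freeVars) :
    IsDigraphFibration (graphOf A).bindingGraph (graphOf B).bindingGraph φ := by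
  constructor
  · intro b l h
    obtain ⟨x, a, h1, h2, h3⟩ := hA.bindingGraph_adj_iff.1 h
    refine hB.bindingGraph_adj_iff.2 ⟨ρ x, a.rename ρ, ?_, ?_, ?_⟩
    · exact (hφ b).trans (congrArg _ h1)
    · rw [hφ, h2]; rfl
    · rw [Atom.vars_rename]; exact Finset.mem_image_of_mem _ h3
  · intro v w h
    obtain ⟨x', a', h1, h2, h3⟩ := hB.bindingGraph_adj_iff.1 h
    rw [hφ] at h2
    cases hv : lab A v with
    | binder y => rw [hv] at h2; cases h2
    | lit a =>
      rw [hv] at h2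
      cases h2
      rw [Atom.vars_rename] at h3
      obtain ⟨x, hx, rfl⟩ := Finset.mem_image.1 h3
      -- Were `x` free in `A`, its image would be free in `B`, yet `w` binds it there, against
      -- rectification of `B`.
      have hxA : x ∈ A.boundVars := by
        refine (mem_vars_iff.1 (mem_vars_of_label (v := v) (by rw [hv]; exact hx))).resolve_left
          fun hf => ?_
        exact hB.2 _ (mem_boundVars_iff.2 ⟨w, h1⟩) (hfree x hf)
      obtain ⟨b, hb⟩ := mem_boundVars_iff.1 hxA
      have lift : ∀ y b, (graphOf A).IsBinderOf y b → (graphOf B).IsBinderOf (ρ y) (φ b) :=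
        fun y b h => (hφ b).trans (congrArg _ h)
      refine ⟨b, ⟨hA.bindingGraph_adj_iff.2 ⟨x, a, hb, hv, hx⟩,
        binder_unique hB.1 (lift x b hb) h1⟩, ?_⟩
      rintro c ⟨hc, rfl⟩
      obtain ⟨y, a', h4, h5, h6⟩ := hA.bindingGraph_adj_iff.1 hc
      rw [hv] at h5
      cases h5
      have : Label.binder (L := L) (ρ y) = .binder (ρ x) := (lift y c h4).symm.trans h1
      -- Uniqueness of the lift: two binders of the same literal with the same image have variables
      -- in one atom, where `ρ` is injective.
      have hyx : y = x := hinj v a hv h6 hx (Label.binder.inj this)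
      exact binder_unique hA.1 (hyx ▸ h4) hb

end RectifiedFormulas

end FOGraph
namespace FOGraph

/-! ### Renaming inside formulas -/

section RenamingFormulas

variable {L : FirstOrder.Language.{u, v}} {α : Type w}

theorem lab_renameVert (ρ : α → α) (A : Form L α) (v : Vert A) :
    lab (A.rename ρ) (renameVert ρ A v) = (lab A v).rename ρ := by
  induction A with
  | atom a => rfl
  | and A B ihA ihB => exact v.casesOn ihA ihB
  | or A B ihA ihB => exact v.casesOn ihA ihB
  | ex x A ih => exact v.casesOn (fun _ => rfl) ih
  | all x A ih => exact v.casesOn (fun _ => rfl) ih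

theorem preservesMaxCliques_renameVert (ρ : α → α) (A : Form L α) :
    PreservesMaxCliques (gr A) (gr (A.rename ρ)) (renameVert ρ A) := by
  induction A with
  | atom a => exact .id
  | and A B ihA ihB => exact ihA.join ihB
  | or A B ihA ihB => exact ihA.sum ihB
  | ex x A ih => exact PreservesMaxCliques.id.join ih
  | all x A ih => exact PreservesMaxCliques.id.sum (V := Unit) (V' := Unit) ih

theorem IsExVertex.renameVert {ρ : α → α} {A : Form L α} {v : Vert A} (hv : IsExVertex A v) :
    IsExVertex (A.rename ρ) (renameVert ρ A v) := by
  induction A with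
  | atom a => exact hv
  | and A B ihA ihB => exact v.casesOn (fun _ h => ihA h) (fun _ h => ihB h) hv
  | or A B ihA ihB => exact v.casesOn (fun _ h => ihA h) (fun _ h => ihB h) hv
  | ex x A ih => exact v.casesOn (fun _ _ => trivial) (fun _ h => ih h) hv
  | all x A ih => exact v.casesOn (fun _ h => h) (fun _ h => ih h) hv

variable [DecidableEq α]

/-- The hypothesis excludes capture: no quantifier on another variable is renamed to `ρ u`. -/
theorem mem_freeVars_rename {ρ : α → α} {A : Form L α} {u : α} (hu : u ∈ A.freeVars)
    (h : ∀ y ∈ A.vars, ρ y = ρ u → y = u) : ρ u ∈ (A.rename ρ).freeVars := by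
  induction A with
  | atom a =>
    simp only [Form.rename, Form.freeVars, Atom.vars_rename] at hu ⊢
    exact Finset.mem_image_of_mem _ hu
  | and A B ihA ihB =>
    simp only [Form.rename, Form.freeVars, Form.vars, Finset.mem_union] at hu h ⊢
    exact hu.imp (fun hu => ihA hu fun y hy => h y (.inl hy))
      (fun hu => ihB hu fun y hy => h y (.inr hy))
  | or A B ihA ihB =>
    simp only [Form.rename, Form.freeVars, Form.vars, Finset.mem_union] at hu h ⊢
    exact hu.imp (fun hu => ihA hu fun y hy => h y (.inl hy))
      (fun hu => ihB hu fun y hy => h y (.inr hy))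
  | ex x A ih =>
    simp only [Form.rename, Form.freeVars, Form.vars, Finset.mem_erase, Finset.mem_insert]
      at hu h ⊢
    exact ⟨fun e => hu.1 (h x (.inl rfl) e.symm).symm, ih hu.2 fun y hy => h y (.inr hy)⟩
  | all x A ih =>
    simp only [Form.rename, Form.freeVars, Form.vars, Finset.mem_erase, Finset.mem_insert]
      at hu h ⊢
    exact ⟨fun e => hu.1 (h x (.inl rfl) e.symm).symm, ih hu.2 fun y hy => h y (.inr hy)⟩

theorem mem_freeVars_replace {x y u : α} {A : Form L α} (hA : NotInPlaceholder x y A)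
    (hu : u ∈ A.freeVars) (huy : u ≠ y) : u ∈ (A.replace y x).freeVars ∧ u ≠ x := by
  have hux : u ≠ x := by
    rintro rfl
    rcases hA with h | h
    exacts [huy h, h (mem_vars_iff.2 (.inl hu))]
  have := mem_freeVars_rename (ρ := Function.update id y x) hu fun z _ hzu => by
    simp only [Function.update_apply, huy, if_false, id] at hzu
    split_ifs at hzu
    exacts [absurd hzu.symm hux, hzu]
  rw [Function.update_of_ne huy] at this
  exact ⟨this, hux⟩

end RenamingFormulas

/-! ### Invariance under the structural equivalence -/

section Equivalences

variable {L : FirstOrder.Language.{u, v}} {α : Type w} [DecidableEq α]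

theorem Equivalence.freeVars_eq {A B : Form L α} (e : Equivalence A B) :
    A.freeVars = B.freeVars := by
  induction e with
  | refl => rfl
  | symm _ ih => exact ih.symm
  | trans _ _ ih1 ih2 => exact ih1.trans ih2
  | andCongr _ _ ih1 ih2 => simp only [Form.freeVars, ih1, ih2]
  | orCongr _ _ ih1 ih2 => simp only [Form.freeVars, ih1, ih2]
  | exCongr _ _ ih => simp only [Form.freeVars, ih]
  | allCongr _ _ ih => simp only [Form.freeVars, ih]
  | andComm => exact Finset.union_comm _ _
  | andAssoc => exact Finset.union_assoc _ _ _
  | orComm => exact Finset.union_comm _ _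
  | orAssoc => exact Finset.union_assoc _ _ _
  | allAll => exact Finset.erase_right_comm
  | allOr x A B h => simp only [Form.freeVars, Finset.erase_union_distrib, Finset.erase_eq_of_notMem h]
  | exEx => exact Finset.erase_right_comm
  | exAnd x A B h => simp only [Form.freeVars, Finset.erase_union_distrib, Finset.erase_eq_of_notMem h]

/-- Adjacency, labels and existential quantifiers are invariant under `≡`. -/
theorem Equivalence.toEquiv_spec {A B : Form L α} (e : Equivalence A B) :
    (∀ v w, (gr B).Adj (e.toEquiv v) (e.toEquiv w) ↔ (gr A).Adj v w) ∧
      (∀ v, lab B (e.toEquiv v) = lab A v) ∧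
      ∀ v, IsExVertex B (e.toEquiv v) ↔ IsExVertex A v := by
  induction e with
  | refl => exact ⟨fun _ _ => Iff.rfl, fun _ => rfl, fun _ => Iff.rfl⟩
  | symm e ih =>
    obtain ⟨h1, h2, h3⟩ := ih
    refine ⟨fun v w => ?_, fun v => ?_, fun v => ?_⟩
    · rw [← h1]; simp [toEquiv]
    · rw [← h2]; simp [toEquiv]
    · rw [← h3]; simp [toEquiv]
  | trans e f ih1 ih2 =>
    obtain ⟨h1, h2, h3⟩ := ih1
    obtain ⟨h4, h5, h6⟩ := ih2
    exact ⟨fun v w => (h4 _ _).trans (h1 v w), fun v => (h5 _).trans (h2 v),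
      fun v => (h6 _).trans (h3 v)⟩
  | andCongr e f ih1 ih2 =>
    obtain ⟨h1, h2, h3⟩ := ih1
    obtain ⟨h4, h5, h6⟩ := ih2
    refine ⟨?_, fun v => v.casesOn h2 h5, fun v => v.casesOn h3 h6⟩
    rintro (v | v) (w | w)
    · exact joinGraph_adj_inl_inl.trans ((h1 v w).trans joinGraph_adj_inl_inl.symm)
    · exact iff_of_true joinGraph_adj_inl_inr joinGraph_adj_inl_inr
    · exact iff_of_true joinGraph_adj_inr_inl joinGraph_adj_inr_inl
    · exact joinGraph_adj_inr_inr.trans ((h4 v w).trans joinGraph_adj_inr_inr.symm)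
  | orCongr e f ih1 ih2 =>
    obtain ⟨h1, h2, h3⟩ := ih1
    obtain ⟨h4, h5, h6⟩ := ih2
    refine ⟨?_, fun v => v.casesOn h2 h5, fun v => v.casesOn h3 h6⟩
    rintro (v | v) (w | w)
    exacts [h1 v w, Iff.rfl, Iff.rfl, h4 v w]
  | exCongr x e ih =>
    obtain ⟨h1, h2, h3⟩ := ih
    refine ⟨?_, fun v => v.casesOn (fun _ => rfl) h2, fun v => v.casesOn (fun _ => Iff.rfl) h3⟩
    rintro (v | v) (w | w)
    · exact joinGraph_adj_inl_inl.trans joinGraph_adj_inl_inl.symm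
    · exact iff_of_true joinGraph_adj_inl_inr joinGraph_adj_inl_inr
    · exact iff_of_true joinGraph_adj_inr_inl joinGraph_adj_inr_inl
    · exact joinGraph_adj_inr_inr.trans ((h1 v w).trans joinGraph_adj_inr_inr.symm)
  | allCongr x e ih =>
    obtain ⟨h1, h2, h3⟩ := ih
    refine ⟨?_, fun v => v.casesOn (fun _ => rfl) h2, fun v => v.casesOn (fun _ => Iff.rfl) h3⟩
    rintro (v | v) (w | w)
    exacts [Iff.rfl, Iff.rfl, Iff.rfl, h1 v w]
  | andComm A B =>
    refine ⟨?_, ?_, ?_⟩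
    · rintro (v | v) (w | w)
      · exact joinGraph_adj_inr_inr.trans joinGraph_adj_inl_inl.symm
      · exact iff_of_true joinGraph_adj_inr_inl joinGraph_adj_inl_inr
      · exact iff_of_true joinGraph_adj_inl_inr joinGraph_adj_inr_inl
      · exact joinGraph_adj_inl_inl.trans joinGraph_adj_inr_inr.symm
    · rintro (v | v) <;> rfl
    · rintro (v | v) <;> exact Iff.rfl
  | andAssoc A B C =>
    refine ⟨?_, ?_, ?_⟩
    · change ∀ v w, (joinGraph (gr A) (joinGraph (gr B) (gr C))).Adj (Equiv.sumAssoc _ _ _ v)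
        (Equiv.sumAssoc _ _ _ w) ↔ (joinGraph (joinGraph (gr A) (gr B)) (gr C)).Adj v w
      rintro ((v | v) | v) ((w | w) | w) <;> simp
    · rintro ((v | v) | v) <;> rfl
    · rintro ((v | v) | v) <;> exact Iff.rfl
  | orComm A B =>
    refine ⟨?_, ?_, ?_⟩
    · rintro (v | v) (w | w) <;> exact Iff.rfl
    · rintro (v | v) <;> rfl
    · rintro (v | v) <;> exact Iff.rfl
  | orAssoc A B C =>
    refine ⟨?_, ?_, ?_⟩
    · rintro ((v | v) | v) ((w | w) | w) <;> exact Iff.rfl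
    · rintro ((v | v) | v) <;> rfl
    · rintro ((v | v) | v) <;> exact Iff.rfl
  | allAll x y A =>
    refine ⟨?_, ?_, ?_⟩
    · rintro (v | v | v) (w | w | w) <;> exact Iff.rfl
    · rintro (v | v | v) <;> rfl
    · rintro (v | v | v) <;> exact Iff.rfl
  | allOr x A B h =>
    refine ⟨?_, ?_, ?_⟩
    · rintro (v | v | v) (w | w | w) <;> exact Iff.rfl
    · rintro (v | v | v) <;> rfl
    · rintro (v | v | v) <;> exact Iff.rfl
  | exEx x y A =>
    refine ⟨?_, ?_, ?_⟩
    · change ∀ v w, (joinGraph (⊥ : SimpleGraph Unit) (joinGraph (⊥ : SimpleGraph Unit)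
        (gr A))).Adj (sumLeftComm _ _ _ v) (sumLeftComm _ _ _ w) ↔
        (joinGraph (⊥ : SimpleGraph Unit) (joinGraph (⊥ : SimpleGraph Unit) (gr A))).Adj v w
      rintro (v | v | v) (w | w | w) <;> simp [sumLeftComm]
    · rintro (v | v | v) <;> rfl
    · rintro (v | v | v) <;> exact Iff.rfl
  | exAnd x A B h =>
    refine ⟨?_, ?_, ?_⟩
    · change ∀ v w, (joinGraph (joinGraph (⊥ : SimpleGraph Unit) (gr A)) (gr B)).Adj
        ((Equiv.sumAssoc _ _ _).symm v) ((Equiv.sumAssoc _ _ _).symm w) ↔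
        (joinGraph (⊥ : SimpleGraph Unit) (joinGraph (gr A) (gr B))).Adj v w
      rintro (v | v | v) (w | w | w) <;> simp
    · rintro (v | v | v) <;> rfl
    · rintro (v | v | v) <;> exact Iff.rfl

end Equivalences

/-! ### The induced map and the renaming of each rule -/

section RuleMaps

variable {L : FirstOrder.Language.{u, v}} {α : Type w} [DecidableEq α]

theorem Rule.preservesMaxCliques {Q P : Form L α} (r : Rule Q P) :
    PreservesMaxCliques (gr Q) (gr P) r.map := by
  cases r with
  | weak A B => exact preservesMaxCliques_inl
  | weakAll x A h => exact preservesMaxCliques_inr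
  | atomContr a =>
    have h := PreservesMaxCliques.sum_elim (V := Unit) (W := Unit) (G := ⊥) (H := ⊥) (K := ⊥)
      .id .id
    have e : Sum.elim id id = fun _ : Unit ⊕ Unit => () := funext fun _ => rfl
    rw [e] at h
    exact h
  | contrAll y x A h =>
    exact PreservesMaxCliques.sum_elim (V := Unit) (preservesMaxCliques_inl (V := Unit)) .id
  | medial A B C D => exact preservesMaxCliques_medial
  | medialAll x y z A B hA hB =>
    exact preservesMaxCliques_mergeMap_sum (preservesMaxCliques_renameVert _ A)
      (preservesMaxCliques_renameVert _ B)
  | medialEx x y z A B hA hB =>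
    exact preservesMaxCliques_mergeMap_join (preservesMaxCliques_renameVert _ A)
      (preservesMaxCliques_renameVert _ B)
  | equiv e => exact preservesMaxCliques_of_equiv e.toEquiv e.toEquiv_spec.1

theorem Rule.isExVertex_map {Q P : Form L α} (r : Rule Q P) {v : Vert Q} (hv : IsExVertex Q v) :
    IsExVertex P (r.map v) := by
  cases r with
  | weak A B => exact hv
  | weakAll x A h => exact hv
  | atomContr a => exact v.casesOn (fun _ h => h.elim) (fun _ h => h.elim) hv
  | contrAll y x A h => exact v.casesOn (fun _ h => h.elim) (fun _ h => h) hv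
  | medial A B C D => obtain (v | v) | (v | v) := v <;> exact hv
  | medialAll x y z A B hA hB =>
    obtain (v | v) | (v | v) := v
    exacts [hv, IsExVertex.renameVert (A := A) hv, hv, IsExVertex.renameVert (A := B) hv]
  | medialEx x y z A B hA hB =>
    obtain (v | v) | (v | v) := v
    exacts [hv, IsExVertex.renameVert (A := A) hv, hv, IsExVertex.renameVert (A := B) hv]
  | equiv e => exact (e.toEquiv_spec.2.2 v).2 hv

/-- The properties of the renaming of variables that comes with an inference rule. -/
structure IsRuleRenaming {Q P : Form L α} (φ : Vert Q → Vert P) (ρ : α → α) : Prop where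
  label : ∀ v, lab P (φ v) = (lab Q v).rename ρ
  injOn : ∀ v a, lab Q v = .lit a → Set.InjOn ρ a.vars
  fixes : ∀ x ∈ Q.freeVars, ρ x = x
  freeVars : Q.freeVars ⊆ P.freeVars

theorem isRuleRenaming_id {Q P : Form L α} {φ : Vert Q → Vert P}
    (h : ∀ v, lab P (φ v) = lab Q v) (h' : Q.freeVars ⊆ P.freeVars) :
    IsRuleRenaming φ id :=
  ⟨fun v => (h v).trans (Label.rename_id _).symm, fun _ _ _ => Function.injective_id.injOn,
    fun _ _ => rfl, h'⟩

/-- The renaming of `y` and `z` to `x`. -/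
def mergeVars (x y z : α) : α → α := fun u => if u = y ∨ u = z then x else u

theorem mergeVars_eq_update_left {x y z u : α} (hu : u ≠ z) :
    mergeVars x y z u = Function.update id y x u := by
  simp [mergeVars, Function.update_apply, hu]

theorem mergeVars_eq_update_right {x y z u : α} (hu : u ≠ y) :
    mergeVars x y z u = Function.update id z x u := by
  simp [mergeVars, Function.update_apply, hu]

/-- Either the update is the identity, or `x` does not occur and cannot collide with the image of
`y`. -/
theorem injOn_update {x y : α} {A : Form L α} (hA : NotInPlaceholder x y A) :
    Set.InjOn (Function.update id y x) (A.vars : Set α) := by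
  intro s hs t ht h
  simp only [Function.update_apply, id] at h
  rcases hA with rfl | hA
  · grind
  · have h1 : s ≠ x := fun e => hA (e ▸ hs)
    have h2 : t ≠ x := fun e => hA (e ▸ ht)
    grind

theorem vars_subset_of_lab {A : Form L α} {v : Vert A} {a : Atom L α} (h : lab A v = .lit a) :
    (a.vars : Set α) ⊆ A.vars := fun x hx =>
  mem_vars_of_label (v := v) (by rw [h]; exact hx)

/-- One global renaming serves both halves: since `z` does not occur in `A` nor `y` in `B`, it
agrees with the separate replacement on each side. Keeping `Q` and `P` abstract lets both quantifier
medials share the argument. -/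
theorem isRuleRenaming_mergeMap {Q P : Form L α} {A B : Form L α} {x y z : α}
    (hA : NotInPlaceholder x y A) (hB : NotInPlaceholder x z B) (hyB : y ∉ B.vars)
    (hzA : z ∉ A.vars) (φ : Vert Q → Vert P)
    (hfree : Q.freeVars = A.freeVars.erase y ∪ B.freeVars.erase z)
    (hfree' : P.freeVars = ((A.replace y x).freeVars ∪ (B.replace z x).freeVars).erase x)
    (hlab : ∀ v, ((lab Q v = .binder y ∨ lab Q v = .binder z) ∧ lab P (φ v) = .binder x) ∨
      (∃ w, lab Q v = lab A w ∧ lab P (φ v) = (lab A w).rename (Function.update id y x)) ∨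
      ∃ w, lab Q v = lab B w ∧ lab P (φ v) = (lab B w).rename (Function.update id z x)) :
    IsRuleRenaming φ (mergeVars x y z) := by
  have eqA : ∀ u ∈ A.vars, mergeVars x y z u = Function.update id y x u :=
    fun u hu => mergeVars_eq_update_left fun e => hzA (e ▸ hu)
  have eqB : ∀ u ∈ B.vars, mergeVars x y z u = Function.update id z x u :=
    fun u hu => mergeVars_eq_update_right fun e => hyB (e ▸ hu)
  constructor
  · intro v
    rcases hlab v with ⟨h1 | h1, h2⟩ | ⟨w, h1, h2⟩ | ⟨w, h1, h2⟩
    · rw [h1, h2]; simp [Label.rename, mergeVars]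
    · rw [h1, h2]; simp [Label.rename, mergeVars]
    · rw [h1, h2]; exact Label.rename_congr fun u hu => (eqA u (mem_vars_of_label hu)).symm
    · rw [h1, h2]; exact Label.rename_congr fun u hu => (eqB u (mem_vars_of_label hu)).symm
  · intro v a ha
    rcases hlab v with ⟨h1 | h1, _⟩ | ⟨w, h1, _⟩ | ⟨w, h1, _⟩
    · rw [h1] at ha; cases ha
    · rw [h1] at ha; cases ha
    · exact ((injOn_update hA).congr fun u hu => (eqA u hu).symm).mono
        (vars_subset_of_lab (h1.symm.trans ha))
    · exact ((injOn_update hB).congr fun u hu => (eqB u hu).symm).mono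
        (vars_subset_of_lab (h1.symm.trans ha))
  · intro u hu
    have : u ≠ y ∧ u ≠ z := by
      rw [hfree, Finset.mem_union, Finset.mem_erase, Finset.mem_erase] at hu
      rcases hu with ⟨h1, h2⟩ | ⟨h1, h2⟩
      · exact ⟨h1, fun e => hzA (e ▸ mem_vars_iff.2 (.inl h2))⟩
      · exact ⟨fun e => hyB (e ▸ mem_vars_iff.2 (.inl h2)), h1⟩
    simp [mergeVars, this]
  · intro u hu
    rw [hfree, Finset.mem_union, Finset.mem_erase, Finset.mem_erase] at hu
    rw [hfree', Finset.mem_erase, Finset.mem_union]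
    rcases hu with ⟨h1, h2⟩ | ⟨h1, h2⟩
    · exact (mem_freeVars_replace hA h2 h1).symm.imp_right .inl
    · exact (mem_freeVars_replace hB h2 h1).symm.imp_right .inr

theorem Rule.exists_isRuleRenaming {Q P : Form L α} (r : Rule Q P) (hQ : Q.Rectified) :
    ∃ ρ : α → α, IsRuleRenaming r.map ρ ∧ ∀ x ∉ r.fresh, ρ x = x := by
  cases r with
  | weak A B =>
    exact ⟨id, isRuleRenaming_id (fun _ => rfl) Finset.subset_union_left, fun _ _ => rfl⟩
  | weakAll x A h =>
    exact ⟨id, isRuleRenaming_id (fun _ => rfl) (Finset.erase_eq_of_notMem h).ge, fun _ _ => rfl⟩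
  | atomContr a =>
    refine ⟨id, isRuleRenaming_id ?_ (Finset.union_self _).le, fun _ _ => rfl⟩
    rintro (v | v) <;> rfl
  | contrAll y x A h =>
    obtain ⟨_, hy⟩ := hQ.of_all
    -- Rectification excludes the degenerate side condition, leaving `y` absent from `A`; so sending
    -- `y` to `x` changes only the outer binder.
    have hyx : y ≠ x := fun e => hy (e ▸ List.mem_cons_self)
    have hyA : y ∉ A.vars := h.resolve_left hyx
    have hρ : ∀ u, u ≠ y → Function.update id y x u = u := fun u hu => by simp [hu]
    have hρA : ∀ u ∈ A.vars, Function.update id y x u = u :=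
      fun u hu => hρ u fun e => hyA (e ▸ hu)
    refine ⟨Function.update id y x, ⟨?_, ?_, ?_, ?_⟩, fun u hu => hρ u ?_⟩
    · rintro (v | v | v)
      · exact congrArg Label.binder (Function.update_self y x id).symm
      · exact congrArg Label.binder (hρ x hyx.symm).symm
      · exact (Label.rename_eq_self fun u hu => hρA u (mem_vars_of_label (A := A) hu)).symm
    · rintro (v | v | v) a ha
      · cases ha
      · cases ha
      · exact (Set.injOn_id _).congr fun u hu =>
          (hρA u (vars_subset_of_lab (A := A) (v := v) ha hu)).symm
    · intro u hu
      exact hρ u (Finset.ne_of_mem_erase hu)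
    · exact Finset.erase_subset _ _
    · rintro rfl
      exact hu (by simp [fresh])
  | medial A B C D =>
    refine ⟨id, isRuleRenaming_id ?_ ?_, fun _ _ => rfl⟩
    · rintro ((v | v) | (v | v)) <;> rfl
    · exact (Finset.union_union_union_comm _ _ _ _).le
  | medialAll x y z A B hA hB =>
    obtain ⟨_, _, h1, h2⟩ := hQ.of_or
    refine ⟨mergeVars x y z, isRuleRenaming_mergeMap hA hB
      (fun h => h1 y List.mem_cons_self (Finset.mem_insert_of_mem h))
      (fun h => h2 z List.mem_cons_self (Finset.mem_insert_of_mem h)) _ rfl rfl ?_, ?_⟩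
    · rintro ((v | v) | (v | v))
      · exact .inl ⟨.inl rfl, rfl⟩
      · exact .inr (.inl ⟨v, rfl, lab_renameVert _ A v⟩)
      · exact .inl ⟨.inr rfl, rfl⟩
      · exact .inr (.inr ⟨v, rfl, lab_renameVert _ B v⟩)
    · intro u hu
      simp only [fresh, Finset.mem_insert, Finset.mem_singleton, not_or] at hu
      simp [mergeVars, hu]
  | medialEx x y z A B hA hB =>
    obtain ⟨_, _, h1, h2⟩ := hQ.of_or
    refine ⟨mergeVars x y z, isRuleRenaming_mergeMap hA hB
      (fun h => h1 y List.mem_cons_self (Finset.mem_insert_of_mem h))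
      (fun h => h2 z List.mem_cons_self (Finset.mem_insert_of_mem h)) _ rfl rfl ?_, ?_⟩
    · rintro ((v | v) | (v | v))
      · exact .inl ⟨.inl rfl, rfl⟩
      · exact .inr (.inl ⟨v, rfl, lab_renameVert _ A v⟩)
      · exact .inl ⟨.inr rfl, rfl⟩
      · exact .inr (.inr ⟨v, rfl, lab_renameVert _ B v⟩)
    · intro u hu
      simp only [fresh, Finset.mem_insert, Finset.mem_singleton, not_or] at hu
      simp [mergeVars, hu]
  | equiv e =>
    exact ⟨id, isRuleRenaming_id e.toEquiv_spec.2.1 e.freeVars_eq.le, fun _ _ => rfl⟩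

end RuleMaps

/-! ### Passage to contexts -/

section Contexts

variable {L : FirstOrder.Language.{u, v}} {α : Type w}

theorem PreservesMaxCliques.ctx_map {Q P : Form L α} {φ : Vert Q → Vert P}
    (h : PreservesMaxCliques (gr Q) (gr P) φ) (S : Ctx L α) :
    PreservesMaxCliques (gr (S.fill Q)) (gr (S.fill P)) (S.map φ) := by
  induction S with
  | hole => exact h
  | andLeft S B ih => exact ih.join .id
  | andRight B S ih => exact PreservesMaxCliques.id.join ih
  | orLeft S B ih => exact ih.sum .id
  | orRight B S ih => exact PreservesMaxCliques.id.sum ih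
  | ex x S ih => exact PreservesMaxCliques.id.join ih
  | all x S ih => exact PreservesMaxCliques.id.sum (V := Unit) (V' := Unit) ih

theorem isExVertex_ctx_map {Q P : Form L α} {φ : Vert Q → Vert P}
    (h : ∀ v, IsExVertex Q v → IsExVertex P (φ v)) (S : Ctx L α) :
    ∀ v, IsExVertex (S.fill Q) v → IsExVertex (S.fill P) (S.map φ v) := by
  induction S with
  | hole => exact h
  | andLeft S B ih => exact fun v => v.casesOn ih fun _ h => h
  | andRight B S ih => exact fun v => v.casesOn (fun _ h => h) ih
  | orLeft S B ih => exact fun v => v.casesOn ih fun _ h => h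
  | orRight B S ih => exact fun v => v.casesOn (fun _ h => h) ih
  | ex x S ih => exact fun v => v.casesOn (fun _ h => h) ih
  | all x S ih => exact fun v => v.casesOn (fun _ h => h) ih

variable [DecidableEq α]

theorem Form.Rectified.of_fill {S : Ctx L α} {Q : Form L α} (h : (S.fill Q).Rectified) :
    Q.Rectified := by
  induction S with
  | hole => exact h
  | andLeft S B ih => exact ih h.of_and.1
  | andRight B S ih => exact ih h.of_and.2.1
  | orLeft S B ih => exact ih h.of_or.1
  | orRight B S ih => exact ih h.of_or.2.1
  | ex x S ih => exact ih h.of_ex.1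
  | all x S ih => exact ih h.of_all.1

theorem lab_rename_of_fixes {ρ : α → α} {B : Form L α} (h : ∀ x ∈ B.vars, ρ x = x) (v : Vert B) :
    lab B v = (lab B v).rename ρ :=
  (Label.rename_eq_self fun x hx => h x (mem_vars_of_label hx)).symm

theorem injOn_of_fixes {ρ : α → α} {B : Form L α} (h : ∀ x ∈ B.vars, ρ x = x) (v : Vert B)
    (a : Atom L α) (ha : lab B v = .lit a) : Set.InjOn ρ a.vars :=
  (Set.injOn_id _).congr fun x hx => (h x (vars_subset_of_lab ha hx)).symm

/-- The renaming fixes every variable of the context, so the identity on context vertices is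
compatible with it. -/
theorem IsRuleRenaming.ctx_map {Q P : Form L α} {φ : Vert Q → Vert P} {ρ : α → α}
    (h : IsRuleRenaming φ ρ) {S : Ctx L α} (hS : ∀ x ∈ S.vars, ρ x = x) :
    IsRuleRenaming (S.map φ : Vert (S.fill Q) → Vert (S.fill P)) ρ := by
  have left : ∀ (S : Ctx L α) (B : Form L α), (∀ x ∈ S.vars ∪ B.vars, ρ x = x) →
      (∀ x ∈ S.vars, ρ x = x) ∧ ∀ x ∈ B.vars, ρ x = x := fun S B h =>
    ⟨fun x hx => h x (Finset.mem_union_left _ hx), fun x hx => h x (Finset.mem_union_right _ hx)⟩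
  have right : ∀ (S : Ctx L α) (B : Form L α), (∀ x ∈ B.vars ∪ S.vars, ρ x = x) →
      (∀ x ∈ S.vars, ρ x = x) ∧ ∀ x ∈ B.vars, ρ x = x := fun S B h =>
    ⟨fun x hx => h x (Finset.mem_union_right _ hx), fun x hx => h x (Finset.mem_union_left _ hx)⟩
  induction S with
  | hole => exact h
  | andLeft S B ih =>
    obtain ⟨hS, hB⟩ := left S B hS
    obtain ⟨h1, h2, h3, h4⟩ := ih hS
    exact ⟨fun v => v.casesOn h1 (lab_rename_of_fixes hB),
      fun v => v.casesOn h2 (injOn_of_fixes hB),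
      fun x hx => (Finset.mem_union.1 hx).elim (h3 x) fun h => hB x (mem_vars_iff.2 (.inl h)),
      Finset.union_subset_union_left h4⟩
  | andRight B S ih =>
    obtain ⟨hS, hB⟩ := right S B hS
    obtain ⟨h1, h2, h3, h4⟩ := ih hS
    exact ⟨fun v => v.casesOn (lab_rename_of_fixes hB) h1,
      fun v => v.casesOn (injOn_of_fixes hB) h2,
      fun x hx => (Finset.mem_union.1 hx).elim (fun h => hB x (mem_vars_iff.2 (.inl h))) (h3 x),
      Finset.union_subset_union_right h4⟩
  | orLeft S B ih =>
    obtain ⟨hS, hB⟩ := left S B hS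
    obtain ⟨h1, h2, h3, h4⟩ := ih hS
    exact ⟨fun v => v.casesOn h1 (lab_rename_of_fixes hB),
      fun v => v.casesOn h2 (injOn_of_fixes hB),
      fun x hx => (Finset.mem_union.1 hx).elim (h3 x) fun h => hB x (mem_vars_iff.2 (.inl h)),
      Finset.union_subset_union_left h4⟩
  | orRight B S ih =>
    obtain ⟨hS, hB⟩ := right S B hS
    obtain ⟨h1, h2, h3, h4⟩ := ih hS
    exact ⟨fun v => v.casesOn (lab_rename_of_fixes hB) h1,
      fun v => v.casesOn (injOn_of_fixes hB) h2,
      fun x hx => (Finset.mem_union.1 hx).elim (fun h => hB x (mem_vars_iff.2 (.inl h))) (h3 x),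
      Finset.union_subset_union_right h4⟩
  | ex x S ih =>
    have hx : ρ x = x := hS x (Finset.mem_insert_self _ _)
    obtain ⟨h1, h2, h3, h4⟩ := ih fun y hy => hS y (Finset.mem_insert_of_mem hy)
    exact ⟨fun v => v.casesOn (fun _ => congrArg Label.binder hx.symm) h1,
      fun v => v.casesOn (fun _ _ ha => by cases ha) h2,
      fun y hy => h3 y (Finset.mem_of_mem_erase hy), Finset.erase_subset_erase _ h4⟩
  | all x S ih =>
    have hx : ρ x = x := hS x (Finset.mem_insert_self _ _)
    obtain ⟨h1, h2, h3, h4⟩ := ih fun y hy => hS y (Finset.mem_insert_of_mem hy)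
    exact ⟨fun v => v.casesOn (fun _ => congrArg Label.binder hx.symm) h1,
      fun v => v.casesOn (fun _ _ ha => by cases ha) h2,
      fun y hy => h3 y (Finset.mem_of_mem_erase hy), Finset.erase_subset_erase _ h4⟩

end Contexts

/-! ### Composition along derivations -/

section Derivations

variable {L : FirstOrder.Language.{u, v}} {α : Type w} [DecidableEq α]

theorem Step.preservesMaxCliques {A B : Form L α} (s : Step A B) :
    PreservesMaxCliques (gr A) (gr B) s.map := by
  obtain ⟨S, r, _⟩ := s
  exact r.preservesMaxCliques.ctx_map S

theorem Step.isExVertex_map {A B : Form L α} (s : Step A B) (v : Vert A) (hv : IsExVertex A v) :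
    IsExVertex B (s.map v) := by
  obtain ⟨S, r, _⟩ := s
  exact isExVertex_ctx_map (fun _ => r.isExVertex_map) S v hv

theorem Step.exists_isRuleRenaming {A B : Form L α} (s : Step A B) (hA : A.Rectified) :
    ∃ ρ : α → α, IsRuleRenaming s.map ρ := by
  obtain ⟨S, r, hr⟩ := s
  obtain ⟨ρ, h1, h2⟩ := r.exists_isRuleRenaming hA.of_fill
  exact ⟨ρ, h1.ctx_map fun x hx => h2 x fun h => hr x h hx⟩

theorem Step.isDigraphFibration {A B : Form L α} (s : Step A B) (hA : A.Rectified)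
    (hB : B.Rectified) :
    IsDigraphFibration (graphOf A).bindingGraph (graphOf B).bindingGraph s.map := by
  obtain ⟨ρ, h⟩ := s.exists_isRuleRenaming hA
  exact isDigraphFibration_of_rename hA hB h.label h.injOn fun x hx => by
    rw [h.fixes x hx]
    exact h.freeVars hx

namespace Derivation

variable {A B : Form L α}

theorem map_nil : (nil A).map = id := by simp only [map]

theorem map_snoc {C : Form L α} (Φ : Derivation A B) (s : Step B C) :
    (snoc Φ s).map = s.map ∘ Φ.map := by simp only [map]

theorem rectified_nil : (nil A).Rectified ↔ A.Rectified := by simp only [Rectified]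

theorem rectified_snoc {C : Form L α} {Φ : Derivation A B} {s : Step B C} :
    (snoc Φ s).Rectified ↔ Φ.Rectified ∧ C.Rectified := by simp only [Rectified]

theorem Rectified.source_target {Φ : Derivation A B} (h : Φ.Rectified) :
    A.Rectified ∧ B.Rectified := by
  induction Φ with
  | nil => exact ⟨rectified_nil.1 h, rectified_nil.1 h⟩
  | snoc Φ s ih =>
    obtain ⟨h1, h2⟩ := rectified_snoc.1 h
    exact ⟨(ih h1).1, h2⟩

theorem preservesMaxCliques (Φ : Derivation A B) : PreservesMaxCliques (gr A) (gr B) Φ.map := by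
  induction Φ with
  | nil => rw [map_nil]; exact .id
  | snoc Φ s ih => rw [map_snoc]; exact s.preservesMaxCliques.comp ih

theorem isExVertex_map (Φ : Derivation A B) (v : Vert A) (hv : IsExVertex A v) :
    IsExVertex B (Φ.map v) := by
  induction Φ with
  | nil => rw [map_nil]; exact hv
  | snoc Φ s ih => rw [map_snoc]; exact s.isExVertex_map _ ih

/-- The renaming criterion is applied step by step, so each intermediate line must be rectified. -/
theorem isDigraphFibration {Φ : Derivation A B} (h : Φ.Rectified) :
    IsDigraphFibration (graphOf A).bindingGraph (graphOf B).bindingGraph Φ.map := by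
  induction Φ with
  | nil => rw [map_nil]; exact .id
  | snoc Φ s ih =>
    obtain ⟨h1, h2⟩ := rectified_snoc.1 h
    rw [map_snoc]
    exact (s.isDigraphFibration h1.source_target.2 h2).comp (ih h1)

theorem exists_label_rename {Φ : Derivation A B} (h : Φ.Rectified) :
    ∃ ρ : α → α, ∀ v, lab B (Φ.map v) = (lab A v).rename ρ := by
  induction Φ with
  | nil => rw [map_nil]; exact ⟨id, fun v => (Label.rename_id _).symm⟩
  | snoc Φ s ih =>
    obtain ⟨h1, h2⟩ := rectified_snoc.1 h
    obtain ⟨ρ, hρ⟩ := ih h1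
    obtain ⟨σ, hσ⟩ := s.exists_isRuleRenaming h1.source_target.2
    refine ⟨σ ∘ ρ, fun v => ?_⟩
    rw [← Label.rename_rename, ← hρ, map_snoc]
    exact hσ.label _

end Derivation

/-- A renaming may be taken to be the identity on the variables that do not occur in the source. -/
theorem exists_isFographHom {A B : Form L α} {φ : Vert A → Vert B} {ρ : α → α}
    (hφ : IsGraphHom (gr A) (gr B) φ) (hρ : ∀ v, lab B (φ v) = (lab A v).rename ρ) :
    ∃ ρ, IsFographHom (graphOf A) (graphOf B) φ ρ := by
  classical
  -- Only the values on variables occurring in `A` affect labels; resetting the others gives finite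
  -- support.
  let σ : α → α := fun x => if ∃ v, x ∈ (lab A v).vars then ρ x else x
  refine ⟨σ, hφ, ?_, fun v => (hρ v).trans (Label.rename_congr fun x hx => ?_), fun x hx => ?_⟩
  · refine A.vars.finite_toSet.subset fun x hx => ?_
    by_contra hn
    exact hx (if_neg fun ⟨v, hv⟩ => hn (mem_vars_of_label hv))
  · exact (if_pos ⟨v, hx⟩).symm
  · exact if_neg fun ⟨v, hv⟩ => hx v hv

end Derivations

end FOGraph

theorem mainTheorem10 {L : FirstOrder.Language.{u, v}} {α : Type w} [DecidableEq α]
    {A B : FOGraph.Form L α} (Φ : FOGraph.Derivation A B) (hΦ : Φ.Rectified) :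
    FOGraph.IsSkewBifibration (FOGraph.graphOf A) (FOGraph.graphOf B) Φ.map where
  source := hΦ.source_target.1.isFograph
  target := hΦ.source_target.2.isFograph
  hom := by
    obtain ⟨ρ, hρ⟩ := FOGraph.Derivation.exists_label_rename hΦ
    exact FOGraph.exists_isFographHom Φ.preservesMaxCliques.1 hρ
  existentials b hb := FOGraph.isExistential_graphOf_iff.2
    (Φ.isExVertex_map b (FOGraph.isExistential_graphOf_iff.1 hb))
  skew := Φ.preservesMaxCliques.isSkewFibration
  binding := FOGraph.Derivation.isDigraphFibration hΦ
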